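/- Let $m\ge 0$ be an integer. Let $L(m,3)$ be the lattice crossing formed by $3$ vertical parallel lines placed above $m$ horizontal parallel lines in a rectangle, with its $2(m+3)$ endpoints on the boundary of the rectangle ($3$ on the ceiling, $3$ on the floor, $m$ on the left side and $m$ on the right side), and let $\mathrm{Cat}(m,3)$ be the set of Catalan states, i.e. of crossingless connections between these $2(m+3)$ points. A Kauffman state $s$ of $L(m,3)$ is a choice of a positive or a negative marker at each of the $3m$ crossings; write $p(s)$ and $n(s)$ for the numbers of positive and negative markers, $D_s$ for the diagram obtained by smoothing all crossings according to $s$ (a positive marker joins the upper strand end to the right one and the left one to the lower one; a negative marker joins the upper strand end to the left one and the lower one to the right one), $|D_s|$ for the number of closed components of $D_s$, and $\mathbf K(s)\in\mathrm{Cat}(m,3)$ for the Catalan state obtained by removing these closed components. For $C\in\mathrm{Cat}(m,3)$ put $$C(A)=\sum_{s\,:\,\mathbf K(s)=C}A^{p(s)-n(s)}\,(-A^{2}-A^{-2})^{|D_s|}\in\mathbb Z[A^{\pm1}],$$ and call $C$ realizable if $\mathbf K(s)=C$ for at least one $s$. Let $[2]_{A^4}=1+A^4$ and $[3]_{A^4}=1+A^4+A^8$.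 Let $C\in\mathrm{Cat}(m,3)$ be realizable. Then: (1) There are integers $e$, $a,b\ge 0$ and $k\ge 1$ such that $$C(A)=A^{e}\,[2]_{A^4}^{\,a}\,[3]_{A^4}^{\,b}\,\frac{(A^2+A^{-2})^{2k}-1}{(A^2+A^{-2})^2-1}.$$ (2) There are integers $d$, $N\ge 0$ and $c_0,\dots,c_N$ with $C(A)=\sum_{i=0}^{N}c_iA^{d+4i}$ such that $c_0=c_N=1$, $c_i=c_{N-i}$ for all $0\le i\le N$ (the coefficients are palindromic), and $c_i>0$ for all $0\le i\le N$ (there are no gaps). (3) If some horizontal line that avoids the boundary endpoints cuts $C$ in exactly $3$ points (where $C$ is drawn with the minimal number of intersections with that line), then there are integers $e$ and $a,b\ge 0$ with $C(A)=A^{e}\,[2]_{A^4}^{\,a}\,[3]_{A^4}^{\,b}$. -/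

import Mathlib

/-- The `2 (m + n)` boundary points of an `m × n` rectangle: `x j` on the ceiling and `x' j` on the
floor (both from left to right), `y i` on the left side and `y' i` on the right side (both from top
to bottom). -/
inductive BdryPt (m n : ℕ) : Type
  | x (j : Fin n)
  | x' (j : Fin n)
  | y (i : Fin m)
  | y' (i : Fin m)
  deriving DecidableEq, Fintype

/-- Position of a boundary point when the boundary of the rectangle is traversed clockwise,
starting in the upper left corner. -/
def BdryPt.pos {m n : ℕ} : BdryPt m n → ℕ
  | .x j => j
  | .y' i => n + i
  | .x' j => n + m + (n - 1 - j)
  | .y i => n + m + n + (m - 1 - i)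

/-- A Catalan state, i.e. an element of `Cat(m, n)`: a crossingless connection between the
boundary points. It is recorded by the map sending each boundary point to the other end of its
arc: a fixed-point-free involution such that no two arcs `{a, c}`, `{b, d}` have their ends
interlaced on the boundary. -/
@[ext]
structure CatalanState (m n : ℕ) : Type where
  partner : BdryPt m n → BdryPt m n
  partner_partner : ∀ p, partner (partner p) = p
  partner_ne : ∀ p, partner p ≠ p
  noncrossing : ∀ a b : BdryPt m n,
    ¬ (a.pos < b.pos ∧ b.pos < (partner a).pos ∧ (partner a).pos < (partner b).pos)

/-- The segments into which the `m * n` crossings cut the `n` vertical and `m` horizontal lines of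
the lattice crossing `L(m, n)`: `v i j` is the segment of the `j`-th vertical line having exactly
`i` crossings above it, `h i j` is the segment of the `i`-th horizontal line having exactly `j`
crossings to its left. -/
inductive Segment (m n : ℕ) : Type
  | v (i : Fin (m + 1)) (j : Fin n)
  | h (i : Fin m) (j : Fin (n + 1))
  deriving DecidableEq, Fintype

/-- The segment which ends in a given boundary point. -/
def BdryPt.segment {m n : ℕ} : BdryPt m n → Segment m n
  | .x j => .v 0 j
  | .x' j => .v (Fin.last m) j
  | .y i => .h i 0
  | .y' i => .h i (Fin.last n)

/-- A Kauffman state of `L(m, n)`: a choice of a positive (`true`) or negative (`false`) marker at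
each crossing. -/
abbrev KauffmanState (m n : ℕ) : Type := Fin m → Fin n → Bool

/-- `Joins s a b`: the smoothing of some crossing according to `s` joins the segment `a` to the
segment `b`. As vertical lines lie above horizontal ones, the smoothing according to a positive
marker joins the upper segment of the crossing to the right one and the left one to the lower one;
that according to a negative marker joins the upper one to the left one and the lower one to the
right one. -/
inductive Joins {m n : ℕ} (s : KauffmanState m n) : Segment m n → Segment m n → Prop
  | pos_upper (i : Fin m) (j : Fin n) (hs : s i j = true) :
      Joins s (.v i.castSucc j) (.h i j.succ)
  | pos_lower (i : Fin m) (j : Fin n) (hs : s i j = true) :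
      Joins s (.h i j.castSucc) (.v i.succ j)
  | neg_upper (i : Fin m) (j : Fin n) (hs : s i j = false) :
      Joins s (.v i.castSucc j) (.h i j.castSucc)
  | neg_lower (i : Fin m) (j : Fin n) (hs : s i j = false) :
      Joins s (.v i.succ j) (.h i j.succ)

/-- The diagram `D_s` obtained from `L(m, n)` by smoothing all crossings according to `s`, as a
graph on the set of segments. -/
def smoothing {m n : ℕ} (s : KauffmanState m n) : SimpleGraph (Segment m n) :=
  SimpleGraph.fromRel (Joins s)

/-- `|D_s|`: the number of closed components of `D_s`, i.e. of those containing no boundary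
point. -/
noncomputable def closedComponents {m n : ℕ} (s : KauffmanState m n) : ℕ :=
  Nat.card {c : (smoothing s).ConnectedComponent //
    ∀ p : BdryPt m n, (smoothing s).connectedComponentMk p.segment ≠ c}

/-- `K(s) = C`: the Catalan state `C` is what remains of `D_s` when its closed components are
removed, i.e. the arcs of `C` join the same boundary points as the components of `D_s`. -/
def Realizes {m n : ℕ} (s : KauffmanState m n) (C : CatalanState m n) : Prop :=
  ∀ p q : BdryPt m n,
    C.partner p = q ↔ p ≠ q ∧ (smoothing s).Reachable p.segment q.segment

/-- A Catalan state is realizable if it comes from some Kauffman state. -/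
def CatalanState.Realizable {m n : ℕ} (C : CatalanState m n) : Prop :=
  ∃ s : KauffmanState m n, Realizes s C

/-- `p(s)`: the number of positive markers. -/
def posMarkers {m n : ℕ} (s : KauffmanState m n) : ℕ :=
  (Finset.univ.filter fun c : Fin m × Fin n => s c.1 c.2 = true).card

/-- `n(s)`: the number of negative markers. -/
def negMarkers {m n : ℕ} (s : KauffmanState m n) : ℕ :=
  (Finset.univ.filter fun c : Fin m × Fin n => s c.1 c.2 = false).card

open scoped LaurentPolynomial in
open Classical in
/-- The coefficient `C(A)` of the Catalan state `C` in the Kauffman state sum of `L(m, n)`; the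
variable `A` is `LaurentPolynomial.T 1`, and `A ^ e` is `LaurentPolynomial.T e`. -/
noncomputable def CatalanState.coeff {m n : ℕ} (C : CatalanState m n) : ℤ[T;T⁻¹] :=
  ∑ s : KauffmanState m n with Realizes s C,
    LaurentPolynomial.T ((posMarkers s : ℤ) - (negMarkers s : ℤ)) *
      (-LaurentPolynomial.T 2 - LaurentPolynomial.T (-2)) ^ closedComponents s

/-- The boundary points above a horizontal line which has exactly `i` of the points `y` (and
exactly `i` of the points `y'`) above it. -/
def BdryPt.IsAbove {m n : ℕ} (i : ℕ) : BdryPt m n → Prop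
  | .x _ => True
  | .x' _ => False
  | .y k => k.val < i
  | .y' k => k.val < i

/-- The number of points in which a horizontal line with `i` of the points `y` above it cuts `C`
(drawn without superfluous intersections), i.e. the number of arcs of `C` with one end above and
the other end below that line. -/
noncomputable def CatalanState.horizontalCut {m n : ℕ} (C : CatalanState m n) (i : ℕ) : ℕ :=
  Set.ncard {p : BdryPt m n | p.IsAbove i ∧ ¬ (C.partner p).IsAbove i}

/-- The `q`-analogue `[r]_q = 1 + q + ... + q ^ (r - 1)` of `r`. -/
def qAnalogue {R : Type*} [CommRing R] (q : R) (r : ℕ) : R :=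
  ∑ i ∈ Finset.range r, q ^ i

/-! Smoothed row by row, `L(m, 3)` leaves only three kinds of partial diagram: three through
strands, or one through strand together with a cap joining the left or the right pair of floor
points. `components_of_smoothing` shows that this bookkeeping finds the boundary connections and
closed components of the graph. Hence C(A) is the state sum over all Kauffman states whose `run` is
one fixed tangle.

The second Reidemeister move (`rowSum_capL`, `rowSum_capR`) says that, when a row is summed below a
cap, all but two terms cancel: the cap passes through the row and the strand turns to one side.
Therefore, for a fixed set of arcs B and a strand ending in q, four sums obey a closed linear
recursion: those over the two cap tangles, and those over the three-strand tangles giving (q, B)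
when the left or the right floor pair is joined. With χ = A² + A⁻², a turn changes them, up to a
unit, by capL' = capL, capR' = capR + left, left' = 0, right' = right + χ·left, or by the mirror
image of this (`classData_step_right`, `classData_step_left`).

There are two sources of such classes. With no rows, one of left, right is 1 and the other sums
vanish. Alternating turns then produce powers of χ in left or right and geometric sums 1 + χ² + ⋯ +
χ^(2k-2), possibly times χ, in the caps (`Thin`). Alternatively the outer strands of a three-strand
tangle with sum M leave through both sides (`classData_merge`). The four sums are then M times A,
A⁻¹, A³, A⁻³; the next turn produces the factor χ² - 1 = A⁴ + 1 + A⁻⁴, and since 1 + (χ² - 1) = χ²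
the caps telescope to powers of χ (`Thick`). Three-strand sums are always products of units, χ and
χ² - 1 (`GoodClass.three`), so the induction `Good.step` closes up.

This gives (1). A geometric sum can survive only in a thin class, and there every horizontal line
meets the Catalan state at most once, which gives (3). For (2), positive palindromes in A⁴ are
stable under products and under the recursion for the geometric sums. -/

/-! ### Row-by-row transfer of smoothings -/

/-- The points of the ceiling and of the two sides, with rows numbered from the top. -/
inductive Pt : Type
  | x (j : Fin 3)
  | y (i : ℕ)
  | y' (i : ℕ)

/-- What remains of the first rows of a smoothing of `L(m, 3)`: the arcs `B` between points of the
ceiling and the sides, and how the three points of the floor are joined. In `three p q r B` they are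
joined to `p`, `q`, `r`; in `capL q B` the first two are joined to each other and the third one to
`q`; in `capR q B` the first one is joined to `q` and the last two to each other. -/
inductive Tangle : Type
  | three (p q r : Pt) (B : Set (Sym2 Pt))
  | capL (q : Pt) (B : Set (Sym2 Pt))
  | capR (q : Pt) (B : Set (Sym2 Pt))

namespace Tangle

/-- The effect of a row with the given markers on a tangle. -/
def step (i : ℕ) (w : Fin 3 → Bool) : Tangle → Tangle
  | three p q r B =>
    match w 0, w 1, w 2 with
    | false, false, false => three q r (.y' i) (insert s(p, .y i) B)
    | true, true, true => three (.y i) p q (insert s(r, .y' i) B)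
    | false, true, true => capL q (insert s(p, .y i) (insert s(r, .y' i) B))
    | false, false, true => capR q (insert s(p, .y i) (insert s(r, .y' i) B))
    | true, false, false => three (.y i) r (.y' i) (insert s(p, q) B)
    | true, true, false => three (.y i) p (.y' i) (insert s(q, r) B)
    | true, false, true => capR (.y i) (insert s(r, .y' i) (insert s(p, q) B))
    | false, true, false => capL (.y' i) (insert s(p, .y i) (insert s(q, r) B))
  | capL q B =>
    match w 0, w 1, w 2 with
    | false, false, false => three (.y i) q (.y' i) B
    | true, true, true => capR (.y i) (insert s(q, .y' i) B)
    | false, true, true => capL (.y i) (insert s(q, .y' i) B)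
    | false, false, true => capR (.y i) (insert s(q, .y' i) B)
    | true, false, false => three (.y i) q (.y' i) B
    | true, true, false => three (.y i) q (.y' i) B
    | true, false, true => capR (.y i) (insert s(q, .y' i) B)
    | false, true, false => capL (.y' i) (insert s(q, .y i) B)
  | capR q B =>
    match w 0, w 1, w 2 with
    | false, false, false => capL (.y' i) (insert s(q, .y i) B)
    | true, true, true => three (.y i) q (.y' i) B
    | false, true, true => capL (.y' i) (insert s(q, .y i) B)
    | false, false, true => capR (.y' i) (insert s(q, .y i) B)
    | true, false, false => three (.y i) q (.y' i) B
    | true, true, false => three (.y i) q (.y' i) B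
    | true, false, true => capR (.y i) (insert s(q, .y' i) B)
    | false, true, false => capL (.y' i) (insert s(q, .y i) B)

/-- The number of closed components which arise when a row is added to a tangle. -/
def loops (w : Fin 3 → Bool) : Tangle → ℕ
  | three _ _ _ _ => 0
  | capL _ _ => if w 0 = true ∧ w 1 = false then 1 else 0
  | capR _ _ => if w 1 = true ∧ w 2 = false then 1 else 0

/-- The tangle without rows. -/
def init : Tangle := three (.x 0) (.x 1) (.x 2) ∅

/-- The tangle left by the first rows of a smoothing. -/
def run (s : ℕ → Fin 3 → Bool) : ℕ → Tangle
  | 0 => init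
  | i + 1 => step i (s i) (run s i)

/-- The number of closed components in the first rows of a smoothing. -/
def runLoops (s : ℕ → Fin 3 → Bool) : ℕ → ℕ
  | 0 => 0
  | i + 1 => runLoops s i + loops (s i) (run s i)

end Tangle

/-! ### Tangles as matchings -/

/-- The point lies in the first `i` rows. -/
def Pt.InRows (i : ℕ) : Pt → Prop
  | .x _ => True
  | .y k => k < i
  | .y' k => k < i

theorem Pt.InRows.succ {i : ℕ} {p : Pt} (h : p.InRows i) : p.InRows (i + 1) := by
  cases p <;> simp_all [Pt.InRows] <;> omega

/-- All arcs lie in the first `i` rows and have distinct ends. -/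
def ArcsIn (i : ℕ) (B : Set (Sym2 Pt)) : Prop :=
  ∀ a b, s(a, b) ∈ B → a.InRows i ∧ b.InRows i ∧ a ≠ b

theorem ArcsIn.succ {i : ℕ} {B : Set (Sym2 Pt)} (h : ArcsIn i B) : ArcsIn (i + 1) B :=
  fun a b hab => ⟨(h a b hab).1.succ, (h a b hab).2.1.succ, (h a b hab).2.2⟩

theorem ArcsIn.insert {i : ℕ} {B : Set (Sym2 Pt)} (h : ArcsIn i B) {a b : Pt} (ha : a.InRows i)
    (hb : b.InRows i) (hab : a ≠ b) : ArcsIn i (insert s(a, b) B) := by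
  intro c d hcd
  rcases hcd with hcd | hcd
  · rw [Sym2.eq_iff] at hcd
    rcases hcd with ⟨rfl, rfl⟩ | ⟨rfl, rfl⟩
    · exact ⟨ha, hb, hab⟩
    · exact ⟨hb, ha, hab.symm⟩
  · exact h c d hcd

/-- Every point of the first `i` rows is free or the end of an arc. -/
def Covers (i : ℕ) (F : Set Pt) (B : Set (Sym2 Pt)) : Prop :=
  ∀ z : Pt, z.InRows i → z ∈ F ∨ ∃ u, s(z, u) ∈ B

theorem Covers.step {i : ℕ} {F F' : Set Pt} {B B' : Set (Sym2 Pt)} (h : Covers i F B)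
    (hB : B ⊆ B') (hF : ∀ z ∈ F, z ∈ F' ∨ ∃ u, s(z, u) ∈ B')
    (hy : Pt.y i ∈ F' ∨ ∃ u, s(Pt.y i, u) ∈ B') (hy' : Pt.y' i ∈ F' ∨ ∃ u, s(Pt.y' i, u) ∈ B') :
    Covers (i + 1) F' B' := by
  intro z hz
  by_cases hzi : z.InRows i
  · rcases h z hzi with h | ⟨u, hu⟩
    · exact hF z h
    · exact Or.inr ⟨u, hB hu⟩
  · cases z with
    | x j => exact absurd trivial hzi
    | y k =>
      have : k = i := by simp only [Pt.InRows] at hz hzi; omega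
      subst this; exact hy
    | y' k =>
      have : k = i := by simp only [Pt.InRows] at hz hzi; omega
      subst this; exact hy'

namespace Tangle

/-- The tangle is a matching of the points of the first `i` rows and the floor. -/
def Valid (i : ℕ) : Tangle → Prop
  | three p q r B => p.InRows i ∧ q.InRows i ∧ r.InRows i ∧ p ≠ q ∧ p ≠ r ∧ q ≠ r ∧ ArcsIn i B ∧
      Covers i {p, q, r} B
  | capL q B => q.InRows i ∧ ArcsIn i B ∧ Covers i {q} B
  | capR q B => q.InRows i ∧ ArcsIn i B ∧ Covers i {q} B

theorem inRows_y (i : ℕ) : (Pt.y i).InRows (i + 1) := Nat.lt_succ_self i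

theorem inRows_y' (i : ℕ) : (Pt.y' i).InRows (i + 1) := Nat.lt_succ_self i

theorem ne_y {i : ℕ} {p : Pt} (h : p.InRows i) : p ≠ .y i := by
  rintro rfl; exact absurd h (lt_irrefl i)

theorem ne_y' {i : ℕ} {p : Pt} (h : p.InRows i) : p ≠ .y' i := by
  rintro rfl; exact absurd h (lt_irrefl i)

theorem Valid.step {i : ℕ} {S : Tangle} (h : S.Valid i) (w : Fin 3 → Bool) :
    (S.step i w).Valid (i + 1) := by
  have hyy : Pt.y i ≠ Pt.y' i := by simp
  have b1 := inRows_y i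
  have b2 := inRows_y' i
  cases S with
  | three p q r B =>
    obtain ⟨hp, hq, hr, hpq, hpr, hqr, hB, hc⟩ := h
    have p1 := ne_y hp
    have p2 := ne_y' hp
    have q1 := ne_y hq
    have q2 := ne_y' hq
    have r1 := ne_y hr
    have r2 := ne_y' hr
    have p3 := hp.succ
    have q3 := hq.succ
    have r3 := hr.succ
    have hB' := hB.succ
    unfold Tangle.step
    rcases w 0 <;> rcases w 1 <;> rcases w 2 <;> simp only [Valid] <;>
    · and_intros <;> first
        | assumption
        | exact Ne.symm ‹_›
        | exact ArcsIn.insert ‹_› ‹_› ‹_› ‹_›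
        | exact ArcsIn.insert ‹_› ‹_› ‹_› (Ne.symm ‹_›)
        | exact ArcsIn.insert (ArcsIn.insert ‹_› ‹_› ‹_› ‹_›) ‹_› ‹_› ‹_›
        | (refine hc.step (fun e he => by simp [he]) ?_ ?_ ?_ <;>
            simp only [Set.mem_insert_iff, Set.mem_singleton_iff, forall_eq_or_imp, forall_eq,
              true_or, or_true, and_true, true_and] <;> and_intros <;> right <;>
            first
              | exact ⟨_, Or.inl rfl⟩
              | exact ⟨_, Or.inl Sym2.eq_swap⟩
              | exact ⟨_, Or.inr (Or.inl rfl)⟩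
              | exact ⟨_, Or.inr (Or.inl Sym2.eq_swap)⟩)
  | capL q B =>
    obtain ⟨hq, hB, hc⟩ := h
    have q1 := ne_y hq
    have q2 := ne_y' hq
    have q3 := hq.succ
    have hB' := hB.succ
    unfold Tangle.step
    rcases w 0 <;> rcases w 1 <;> rcases w 2 <;> simp only [Valid] <;>
    · and_intros <;> first
        | assumption
        | exact Ne.symm ‹_›
        | exact ArcsIn.insert ‹_› ‹_› ‹_› ‹_›
        | exact ArcsIn.insert ‹_› ‹_› ‹_› (Ne.symm ‹_›)
        | exact ArcsIn.insert (ArcsIn.insert ‹_› ‹_› ‹_› ‹_›) ‹_› ‹_› ‹_›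
        | (refine hc.step (fun e he => by simp [he]) ?_ ?_ ?_ <;>
            simp only [Set.mem_insert_iff, Set.mem_singleton_iff, forall_eq, true_or, or_true] <;>
            right <;>
            first
              | exact ⟨_, Or.inl rfl⟩
              | exact ⟨_, Or.inl Sym2.eq_swap⟩)
  | capR q B =>
    obtain ⟨hq, hB, hc⟩ := h
    have q1 := ne_y hq
    have q2 := ne_y' hq
    have q3 := hq.succ
    have hB' := hB.succ
    unfold Tangle.step
    rcases w 0 <;> rcases w 1 <;> rcases w 2 <;> simp only [Valid] <;>
    · and_intros <;> first
        | assumption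
        | exact Ne.symm ‹_›
        | exact ArcsIn.insert ‹_› ‹_› ‹_› ‹_›
        | exact ArcsIn.insert ‹_› ‹_› ‹_› (Ne.symm ‹_›)
        | exact ArcsIn.insert (ArcsIn.insert ‹_› ‹_› ‹_› ‹_›) ‹_› ‹_› ‹_›
        | (refine hc.step (fun e he => by simp [he]) ?_ ?_ ?_ <;>
            simp only [Set.mem_insert_iff, Set.mem_singleton_iff, forall_eq, true_or, or_true] <;>
            right <;>
            first
              | exact ⟨_, Or.inl rfl⟩
              | exact ⟨_, Or.inl Sym2.eq_swap⟩)

theorem valid_init : init.Valid 0 := by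
  refine ⟨trivial, trivial, trivial, by simp, by simp, by simp, fun a b h => h.elim, ?_⟩
  intro z hz
  left
  match z, hz with
  | .x j, _ => fin_cases j <;> simp
  | .y k, h => exact absurd h (Nat.not_lt_zero k)
  | .y' k, h => exact absurd h (Nat.not_lt_zero k)

theorem valid_run (s : ℕ → Fin 3 → Bool) (i : ℕ) : (run s i).Valid i := by
  induction i with
  | zero => exact valid_init
  | succ i ih => exact ih.step (s i)

end Tangle

/-! ### Labellings of segments and generating sets of joins -/

/-- The segments of a lattice crossing with three vertical lines and arbitrarily many rows. -/
abbrev Seg : Type := (ℕ × Fin 3) ⊕ (ℕ × Fin 4)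

namespace Seg

/-- A vertical segment. -/
abbrev v (i : ℕ) (j : Fin 3) : Seg := .inl (i, j)

/-- A horizontal segment. -/
abbrev h (i : ℕ) (j : Fin 4) : Seg := .inr (i, j)

/-- The pairs of segments joined at a crossing. -/
def crossing (k : ℕ) (j : Fin 3) (b : Bool) : List (Seg × Seg) :=
  if b then [(v k j, h k j.succ), (h k j.castSucc, v (k + 1) j)]
  else [(v k j, h k j.castSucc), (v (k + 1) j, h k j.succ)]

/-- The pairs of segments joined in a row. -/
def row (k : ℕ) (w : Fin 3 → Bool) : List (Seg × Seg) :=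
  crossing k 0 (w 0) ++ crossing k 1 (w 1) ++ crossing k 2 (w 2)

/-- The segment which ends in a point. -/
def ofPt : Pt → Seg
  | .x j => v 0 j
  | .y k => h k 0
  | .y' k => h k 3

end Seg

section Topology

open Seg

/-- The labelling is constant on the ends of arcs. -/
def Compatible {X : Type} (f : Seg → X) (B : Set (Sym2 Pt)) : Prop :=
  ∀ a b, s(a, b) ∈ B → f (ofPt a) = f (ofPt b)

theorem Compatible.insert {X : Type} {f : Seg → X} {B : Set (Sym2 Pt)} (h : Compatible f B)
    {p q : Pt} (hpq : f (ofPt p) = f (ofPt q)) : Compatible f (insert s(p, q) B) := by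
  rintro a b (hab | hab)
  · rw [Sym2.eq_iff] at hab
    rcases hab with ⟨rfl, rfl⟩ | ⟨rfl, rfl⟩
    · exact hpq
    · exact hpq.symm
  · exact h a b hab

namespace Tangle

/-- The labelling of the segments is constant on the strands of the tangle. -/
def Labelled {X : Type} (f : Seg → X) (i : ℕ) : Tangle → Prop
  | three p q r B => f (ofPt p) = f (v i 0) ∧ f (ofPt q) = f (v i 1) ∧ f (ofPt r) = f (v i 2) ∧
      Compatible f B
  | capL q B => f (v i 0) = f (v i 1) ∧ f (ofPt q) = f (v i 2) ∧ Compatible f B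
  | capR q B => f (ofPt q) = f (v i 0) ∧ f (v i 1) = f (v i 2) ∧ Compatible f B

/-- A set of segments whose labels occur at the boundary of the first `i` rows or among given
ones. -/
def Reaches {X : Type} (f : Seg → X) (i : ℕ) (reps : List Seg) (σ : Seg) : Prop :=
  (∃ p : Pt, p.InRows i ∧ f σ = f (ofPt p)) ∨ (∃ j, f σ = f (v i j)) ∨ ∃ r ∈ reps, f σ = f r

/-- The pairs joined in a row can be replaced by as many fewer as components are closed, and every
labelling compatible with them and the tangle above the row labels the tangle below it. -/
def RowGenerated (i : ℕ) (w : Fin 3 → Bool) (S : Tangle) : Prop :=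
  ∃ (E : List (Seg × Seg)) (reps : List Seg), E.length + S.loops w = 6 ∧
    reps.length = S.loops w ∧ (∀ e ∈ E, e ∈ row i w) ∧
    ∀ (X : Type) (f : Seg → X), (∀ e ∈ E, f e.1 = f e.2) → S.Labelled f i →
      (∀ e ∈ row i w, f e.1 = f e.2) ∧ (S.step i w).Labelled f (i + 1) ∧
      ∀ j, Reaches f (i + 1) reps (v i j)

theorem rowGenerated_three {i : ℕ} {p q r : Pt} {B : Set (Sym2 Pt)}
    (hS : (three p q r B).Valid i) (w : Fin 3 → Bool) : RowGenerated i w (three p q r B) := by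
  have hy := inRows_y i
  have hy' := inRows_y' i
  have ey : ofPt (.y i) = h i 0 := rfl
  have ey' : ofPt (.y' i) = h i 3 := rfl
  obtain ⟨hp, hq, hr, -⟩ := hS
  refine ⟨row i w, [], ?_, rfl, fun e he => he, ?_⟩
  · rcases h0 : w 0 <;> rcases h1 : w 1 <;> rcases h2 : w 2 <;>
      simp [row, crossing, loops, h0, h1, h2]
  · rintro X f hf ⟨fp, fq, fr, fB⟩
    refine ⟨hf, ?_, ?_⟩
    · rcases h0 : w 0 <;> rcases h1 : w 1 <;> rcases h2 : w 2 <;>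
        simp [row, crossing, h0, h1, h2] at hf <;>
        simp only [Tangle.step, h0, h1, h2, Labelled] <;> and_intros <;>
        first
          | exact fB.insert (by grind)
          | exact (fB.insert (by grind)).insert (by grind)
          | grind
    · intro j
      left
      fin_cases j
      · exact ⟨p, hp.succ, fp.symm⟩
      · exact ⟨q, hq.succ, fq.symm⟩
      · exact ⟨r, hr.succ, fr.symm⟩

theorem rowGenerated_capL {i : ℕ} {q : Pt} {B : Set (Sym2 Pt)}
    (hS : (capL q B).Valid i) (w : Fin 3 → Bool) : RowGenerated i w (capL q B) := by
  have hy := inRows_y i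
  have hy' := inRows_y' i
  have ey : ofPt (.y i) = h i 0 := rfl
  have ey' : ofPt (.y' i) = h i 3 := rfl
  obtain ⟨hq, -⟩ := hS
  by_cases hl : w 0 = true ∧ w 1 = false
  · obtain ⟨h0, h1⟩ := hl
    -- The loop `v i 0`, `h i 1`, `v i 1` closes up. Its last join `(v i 1, h i 1)` follows from the
    -- first one and the cap, so it is omitted; `v i 0` represents the closed component.
    refine ⟨crossing i 0 (w 0) ++ [(v (i + 1) 1, h i 2)] ++ crossing i 2 (w 2), [v i 0],
      ?_, ?_, ?_, ?_⟩
    · rcases h2 : w 2 <;> simp [crossing, loops, h0, h1]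
    · simp [loops, h0, h1]
    · rcases h2 : w 2 <;> simp [row, crossing, h0, h1, h2]
    · rintro X f hf ⟨f0, f1, fB⟩
      have hf' : ∀ e ∈ row i w, f e.1 = f e.2 := by
        rcases h2 : w 2 <;> simp [row, crossing, h0, h1, h2] at hf ⊢ <;> grind
      refine ⟨hf', ?_, ?_⟩
      · rcases h2 : w 2 <;>
          simp [row, crossing, h0, h1, h2] at hf' <;>
          simp only [Tangle.step, h0, h1, h2, Labelled] <;> and_intros <;>
          first
            | exact fB
            | exact fB.insert (by grind)
            | grind
      · have hrep : ∀ j, f (v i j) = f (v i 0) → Reaches f (i + 1) [v i 0] (v i j) :=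
          fun j hj => Or.inr (Or.inr ⟨_, by simp, hj⟩)
        have hfree : ∀ j, f (ofPt q) = f (v i j) → Reaches f (i + 1) [v i 0] (v i j) :=
          fun j hj => Or.inl ⟨q, hq.succ, hj.symm⟩
        intro j
        fin_cases j <;> first
          | exact hrep _ rfl
          | exact hrep _ (by simpa using f0.symm)
          | exact hrep _ (by simpa using f1.symm)
          | exact hfree _ f0
          | exact hfree _ f1
  · refine ⟨row i w, [], ?_, by simp [loops, hl], fun e he => he, ?_⟩
    · rcases h0 : w 0 <;> rcases h1 : w 1 <;> rcases h2 : w 2 <;>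
        simp_all [row, crossing, loops]
    · rintro X f hf ⟨f0, f1, fB⟩
      refine ⟨hf, ?_, ?_⟩
      · rcases h0 : w 0 <;> rcases h1 : w 1 <;> rcases h2 : w 2 <;>
          simp [row, crossing, h0, h1, h2] at hf hl <;>
          simp only [Tangle.step, h0, h1, h2, Labelled] <;> and_intros <;>
          first
            | exact fB
            | exact fB.insert (by grind)
            | grind
      -- Without a loop, the cap leaves either through the left side, when `w 0` is negative, or
      -- through the middle of the new floor, when the first two markers are positive.
      · have hcap : (f (v i 0) = f (ofPt (.y i))) ∨ f (v i 0) = f (v (i + 1) 1) := by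
          rcases h0 : w 0 <;> rcases h1 : w 1 <;> rcases h2 : w 2 <;>
            simp [row, crossing, h0, h1, h2] at hf hl <;> grind
        have hcap' : ∀ j, f (v i j) = f (v i 0) → Reaches f (i + 1) [] (v i j) := by
          intro j hj
          rcases hcap with h | h
          · exact Or.inl ⟨_, hy, hj.trans h⟩
          · exact Or.inr (Or.inl ⟨_, hj.trans h⟩)
        have hfree : ∀ j, f (ofPt q) = f (v i j) → Reaches f (i + 1) [] (v i j) :=
          fun j hj => Or.inl ⟨q, hq.succ, hj.symm⟩
        intro j
        fin_cases j <;> first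
          | exact hcap' _ rfl
          | exact hcap' _ f0.symm
          | exact hcap' _ f0
          | exact hcap' _ f1.symm
          | exact hcap' _ f1
          | exact hfree _ f0
          | exact hfree _ f1

theorem rowGenerated_capR {i : ℕ} {q : Pt} {B : Set (Sym2 Pt)}
    (hS : (capR q B).Valid i) (w : Fin 3 → Bool) : RowGenerated i w (capR q B) := by
  have hy := inRows_y i
  have hy' := inRows_y' i
  have ey : ofPt (.y i) = h i 0 := rfl
  have ey' : ofPt (.y' i) = h i 3 := rfl
  obtain ⟨hq, -⟩ := hS
  by_cases hl : w 1 = true ∧ w 2 = false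
  · obtain ⟨h1, h2⟩ := hl
    -- Here the redundant join is `(v i 2, h i 2)`, and `v i 1` represents the loop.
    refine ⟨crossing i 0 (w 0) ++ crossing i 1 (w 1) ++ [(v (i + 1) 2, h i 3)], [v i 1],
      ?_, ?_, ?_, ?_⟩
    · rcases h0 : w 0 <;> simp [crossing, loops, h1, h2]
    · simp [loops, h1, h2]
    · rcases h0 : w 0 <;> simp [row, crossing, h0, h1, h2]
    · rintro X f hf ⟨f0, f1, fB⟩
      have hf' : ∀ e ∈ row i w, f e.1 = f e.2 := by
        rcases h0 : w 0 <;> simp [row, crossing, h0, h1, h2] at hf ⊢ <;> grind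
      refine ⟨hf', ?_, ?_⟩
      · rcases h0 : w 0 <;>
          simp [row, crossing, h0, h1, h2] at hf' <;>
          simp only [Tangle.step, h0, h1, h2, Labelled] <;> and_intros <;>
          first
            | exact fB
            | exact fB.insert (by grind)
            | grind
      · have hrep : ∀ j, f (v i j) = f (v i 1) → Reaches f (i + 1) [v i 1] (v i j) :=
          fun j hj => Or.inr (Or.inr ⟨_, by simp, hj⟩)
        have hfree : ∀ j, f (ofPt q) = f (v i j) → Reaches f (i + 1) [v i 1] (v i j) :=
          fun j hj => Or.inl ⟨q, hq.succ, hj.symm⟩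
        intro j
        fin_cases j <;> first
          | exact hrep _ rfl
          | exact hrep _ (by simpa using f0.symm)
          | exact hrep _ (by simpa using f1.symm)
          | exact hfree _ f0
  · refine ⟨row i w, [], ?_, by simp [loops, hl], fun e he => he, ?_⟩
    · rcases h0 : w 0 <;> rcases h1 : w 1 <;> rcases h2 : w 2 <;>
        simp_all [row, crossing, loops]
    · rintro X f hf ⟨f0, f1, fB⟩
      refine ⟨hf, ?_, ?_⟩
      · rcases h0 : w 0 <;> rcases h1 : w 1 <;> rcases h2 : w 2 <;>
          simp [row, crossing, h0, h1, h2] at hf hl <;>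
          simp only [Tangle.step, h0, h1, h2, Labelled] <;> and_intros <;>
          first
            | exact fB
            | exact fB.insert (by grind)
            | grind
      · have hcap : (f (v i 2) = f (ofPt (.y' i))) ∨ f (v i 2) = f (v (i + 1) 1) := by
          rcases h0 : w 0 <;> rcases h1 : w 1 <;> rcases h2 : w 2 <;>
            simp [row, crossing, h0, h1, h2] at hf hl <;> grind
        have hcap' : ∀ j, f (v i j) = f (v i 2) → Reaches f (i + 1) [] (v i j) := by
          intro j hj
          rcases hcap with h | h
          · exact Or.inl ⟨_, hy', hj.trans h⟩
          · exact Or.inr (Or.inl ⟨_, hj.trans h⟩)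
        have hfree : ∀ j, f (ofPt q) = f (v i j) → Reaches f (i + 1) [] (v i j) :=
          fun j hj => Or.inl ⟨q, hq.succ, hj.symm⟩
        intro j
        fin_cases j <;> first
          | exact hcap' _ rfl
          | exact hcap' _ f0.symm
          | exact hcap' _ f0
          | exact hcap' _ f1.symm
          | exact hcap' _ f1
          | exact hfree _ f0

theorem rowGenerated {i : ℕ} {S : Tangle} (hS : S.Valid i) (w : Fin 3 → Bool) :
    RowGenerated i w S :=
  match S, hS with
  | three _ _ _ _, hS => rowGenerated_three hS w
  | capL _ _, hS => rowGenerated_capL hS w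
  | capR _ _, hS => rowGenerated_capR hS w

end Tangle

theorem Seg.crossing_subset_row {k : ℕ} {w : Fin 3 → Bool} {c : Fin 3} {e : Seg × Seg}
    (he : e ∈ crossing k c (w c)) : e ∈ row k w := by
  unfold row
  match c, he with
  | 0, he => exact List.mem_append_left _ (List.mem_append_left _ he)
  | 1, he => exact List.mem_append_left _ (List.mem_append_right _ he)
  | 2, he => exact List.mem_append_right _ he

namespace Tangle

/-- Each closed component makes one of the six joins of a row redundant, so 6i minus the number of
loops of them suffice. Arbitrary labellings are allowed because two are needed: the map to connected
components, for the upper bounds, and a labelling with many values, for the lower bound on the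
number of components. -/
theorem exists_generators (s : ℕ → Fin 3 → Bool) (i : ℕ) :
    ∃ (E : List (Seg × Seg)) (reps : List Seg), E.length + runLoops s i = 6 * i ∧
      reps.length = runLoops s i ∧ (∀ e ∈ E, ∃ k < i, e ∈ row k (s k)) ∧
      ∀ (X : Type) (f : Seg → X), (∀ e ∈ E, f e.1 = f e.2) →
        (∀ k < i, ∀ e ∈ row k (s k), f e.1 = f e.2) ∧ (run s i).Labelled f i ∧
        (∀ k ≤ i, ∀ j, Reaches f i reps (v k j)) ∧ ∀ k < i, ∀ j, Reaches f i reps (h k j) := by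
  induction i with
  | zero =>
    refine ⟨[], [], rfl, rfl, by simp, fun X f _ => ⟨by simp, ?_, ?_, by simp⟩⟩
    · exact ⟨rfl, rfl, rfl, fun a b h => h.elim⟩
    · intro k hk j
      obtain rfl : k = 0 := by omega
      exact Or.inr (Or.inl ⟨j, rfl⟩)
  | succ i ih =>
    obtain ⟨E, reps, hE, hreps, hsub, hlab⟩ := ih
    obtain ⟨E', reps', hE', hreps', hsub', hlab'⟩ := rowGenerated (valid_run s i) (s i)
    refine ⟨E' ++ E, reps' ++ reps, ?_, ?_, ?_, ?_⟩
    · simp only [List.length_append, runLoops]; omega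
    · simp only [List.length_append, runLoops]; omega
    · intro e he
      rcases List.mem_append.1 he with he | he
      · exact ⟨i, by omega, hsub' e he⟩
      · obtain ⟨k, hk, hke⟩ := hsub e he
        exact ⟨k, by omega, hke⟩
    · intro X f hf
      obtain ⟨h1, h2, h3, h4⟩ := hlab X f fun e he => hf e (List.mem_append_right _ he)
      obtain ⟨g1, g2, g3⟩ := hlab' X f (fun e he => hf e (List.mem_append_left _ he)) h2
      have hrow : ∀ k < i + 1, ∀ e ∈ row k (s k), f e.1 = f e.2 := by
        intro k hk
        rcases Nat.lt_succ_iff_lt_or_eq.1 hk with hk | rfl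
        · exact h1 k hk
        · exact g1
      have hnew : ∀ j, Reaches f (i + 1) (reps' ++ reps) (v i j) := by
        intro j
        rcases g3 j with h | h | ⟨r, hr, h⟩
        · exact Or.inl h
        · exact Or.inr (Or.inl h)
        · exact Or.inr (Or.inr ⟨r, List.mem_append_left _ hr, h⟩)
      have htrans : ∀ σ τ, f σ = f τ → Reaches f (i + 1) (reps' ++ reps) τ →
          Reaches f (i + 1) (reps' ++ reps) σ := by
        intro σ τ hστ hτ
        unfold Reaches at hτ ⊢
        rwa [hστ]
      have hold : ∀ σ, Reaches f i reps σ → Reaches f (i + 1) (reps' ++ reps) σ := by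
        rintro σ (⟨p, hp, h⟩ | ⟨j, h⟩ | ⟨r, hr, h⟩)
        · exact Or.inl ⟨p, hp.succ, h⟩
        · exact htrans _ _ h (hnew j)
        · exact Or.inr (Or.inr ⟨r, List.mem_append_right _ hr, h⟩)
      have hfloor : ∀ j, Reaches f (i + 1) (reps' ++ reps) (v (i + 1) j) :=
        fun j => Or.inr (Or.inl ⟨j, rfl⟩)
      refine ⟨hrow, g2, ?_, ?_⟩
      · intro k hk j
        rcases Nat.le_succ_iff.1 hk with hk | rfl
        · exact hold _ (h3 k hk j)
        · exact hfloor j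
      · intro k hk j
        rcases Nat.lt_succ_iff_lt_or_eq.1 hk with hk | rfl
        · exact hold _ (h4 k hk j)
        -- Every horizontal segment but the leftmost is the right end at a crossing, and a smoothing
        -- always joins it to a vertical segment.
        · have hc : ∀ c : Fin 3, f (h k c.succ) = f (v k c) ∨ f (h k c.succ) = f (v (k + 1) c) := by
            intro c
            have hg : ∀ e ∈ crossing k c (s k c), f e.1 = f e.2 := by
              intro e he
              exact g1 e (crossing_subset_row he)
            cases hb : s k c <;> simp [crossing, hb] at hg
            · exact Or.inr hg.2.symm
            · exact Or.inl hg.1.symm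
          refine Fin.cases ?_ (fun c => ?_) j
          · exact Or.inl ⟨.y k, inRows_y k, rfl⟩
          · rcases hc c with hc | hc
            · exact htrans _ _ hc (hnew c)
            · exact htrans _ _ hc (hfloor c)

/-- Two distinct ends of the tangle are joined by it. -/
def Conn : Tangle → Pt ⊕ Fin 3 → Pt ⊕ Fin 3 → Prop
  | three _ _ _ B, .inl a, .inl b => s(a, b) ∈ B
  | three p q r _, .inl a, .inr j => a = ![p, q, r] j
  | three p q r _, .inr j, .inl a => a = ![p, q, r] j
  | three _ _ _ _, .inr _, .inr _ => False
  | capL _ B, .inl a, .inl b => s(a, b) ∈ B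
  | capL q _, .inl a, .inr j => j = 2 ∧ a = q
  | capL q _, .inr j, .inl a => j = 2 ∧ a = q
  | capL _ _, .inr j, .inr k => j ≠ k ∧ j ≠ 2 ∧ k ≠ 2
  | capR _ B, .inl a, .inl b => s(a, b) ∈ B
  | capR q _, .inl a, .inr j => j = 0 ∧ a = q
  | capR q _, .inr j, .inl a => j = 0 ∧ a = q
  | capR _ _, .inr j, .inr k => j ≠ k ∧ j ≠ 0 ∧ k ≠ 0

/-- The segment which ends in an end of a tangle. -/
def endSeg (i : ℕ) : Pt ⊕ Fin 3 → Seg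
  | .inl p => ofPt p
  | .inr j => v i j

/-- The end belongs to the first `i` rows. -/
def EndInRows (i : ℕ) : Pt ⊕ Fin 3 → Prop
  | .inl p => p.InRows i
  | .inr _ => True

theorem Labelled.conn {X : Type} {f : Seg → X} {i : ℕ} {S : Tangle} (hS : S.Labelled f i)
    {a b : Pt ⊕ Fin 3} (hab : S.Conn a b) : f (endSeg i a) = f (endSeg i b) := by
  cases S with
  | three p q r B =>
    obtain ⟨hp, hq, hr, hB⟩ := hS
    rcases a with a | j <;> rcases b with b | k
    · exact hB a b hab
    · obtain rfl : a = ![p, q, r] k := hab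
      fin_cases k <;> assumption
    · obtain rfl : b = ![p, q, r] j := hab
      fin_cases j <;> exact Eq.symm ‹_›
    · exact hab.elim
  | capL q B =>
    obtain ⟨h01, hq, hB⟩ := hS
    rcases a with a | j <;> rcases b with b | k
    · exact hB a b hab
    · obtain ⟨rfl, rfl⟩ := hab
      exact hq
    · obtain ⟨rfl, rfl⟩ := hab
      exact hq.symm
    · obtain ⟨h1, h2, h3⟩ := hab
      fin_cases j <;> fin_cases k <;> simp_all [endSeg]
  | capR q B =>
    obtain ⟨hq, h12, hB⟩ := hS
    rcases a with a | j <;> rcases b with b | k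
    · exact hB a b hab
    · obtain ⟨rfl, rfl⟩ := hab
      exact hq
    · obtain ⟨rfl, rfl⟩ := hab
      exact hq.symm
    · obtain ⟨h1, h2, h3⟩ := hab
      fin_cases j <;> fin_cases k <;> simp_all [endSeg]

theorem Valid.arcsIn {i : ℕ} {S : Tangle} (hS : S.Valid i) {a b : Pt}
    (hab : S.Conn (.inl a) (.inl b)) : a.InRows i ∧ b.InRows i ∧ a ≠ b := by
  cases S with
  | three p q r B => exact hS.2.2.2.2.2.2.1 a b hab
  | capL q B => exact hS.2.1 a b hab
  | capR q B => exact hS.2.1 a b hab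

theorem Valid.conn_ne {i : ℕ} {S : Tangle} (hS : S.Valid i) {a b : Pt ⊕ Fin 3}
    (hab : S.Conn a b) : a ≠ b := by
  rcases a with a | j <;> rcases b with b | k
  · simpa using (hS.arcsIn hab).2.2
  · simp
  · simp
  · cases S <;> simp_all [Conn]

theorem Valid.exists_conn {i : ℕ} {S : Tangle} (hS : S.Valid i) {a : Pt ⊕ Fin 3}
    (ha : EndInRows i a) : ∃ b, EndInRows i b ∧ S.Conn a b := by
  rcases a with a | j
  · suffices (∃ j, S.Conn (.inl a) (.inr j)) ∨ ∃ b, S.Conn (.inl a) (.inl b) by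
      rcases this with ⟨j, hj⟩ | ⟨b, hb⟩
      · exact ⟨.inr j, trivial, hj⟩
      · exact ⟨.inl b, (hS.arcsIn hb).2.1, hb⟩
    cases S with
    | three p q r B =>
      rcases hS.2.2.2.2.2.2.2 a ha with (rfl | rfl | rfl) | h
      · exact Or.inl ⟨0, rfl⟩
      · exact Or.inl ⟨1, rfl⟩
      · exact Or.inl ⟨2, rfl⟩
      · exact Or.inr h
    | capL q B =>
      rcases hS.2.2 a ha with rfl | h
      · exact Or.inl ⟨2, rfl, rfl⟩
      · exact Or.inr h
    | capR q B =>
      rcases hS.2.2 a ha with rfl | h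
      · exact Or.inl ⟨0, rfl, rfl⟩
      · exact Or.inr h
  · cases S with
    | three p q r B =>
      refine ⟨.inl (![p, q, r] j), ?_, rfl⟩
      obtain ⟨hp, hq, hr, -⟩ := hS
      fin_cases j <;> assumption
    | capL q B =>
      fin_cases j
      · exact ⟨.inr 1, trivial, by simp [Conn]⟩
      · exact ⟨.inr 0, trivial, by simp [Conn]⟩
      · exact ⟨.inl q, hS.1, by simp [Conn]⟩
    | capR q B =>
      fin_cases j
      · exact ⟨.inl q, hS.1, by simp [Conn]⟩
      · exact ⟨.inr 2, trivial, by simp [Conn]⟩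
      · exact ⟨.inr 1, trivial, by simp [Conn]⟩

/-- Whether floor points 0, 1 or 1, 2 are joined determines the shape of the tangle. Validity
confines all arcs to the first `i` rows, so testing ends there recovers `B` as well. -/
theorem eq_of_conn_iff {i : ℕ} {S S' : Tangle} (hS : S.Valid i) (hS' : S'.Valid i)
    (h : ∀ a b, EndInRows i a → EndInRows i b → (S.Conn a b ↔ S'.Conn a b)) : S = S' := by
  have h' : ∀ a b : Pt, S.Conn (.inl a) (.inl b) ↔ S'.Conn (.inl a) (.inl b) := by
    intro a b
    constructor <;> intro hab
    · exact (h (.inl a) (.inl b) (hS.arcsIn hab).1 (hS.arcsIn hab).2.1).1 hab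
    · exact (h (.inl a) (.inl b) (hS'.arcsIn hab).1 (hS'.arcsIn hab).2.1).2 hab
  have hB : ∀ B B' : Set (Sym2 Pt), (∀ a b, s(a, b) ∈ B ↔ s(a, b) ∈ B') → B = B' :=
    fun B B' hBB => Set.ext fun e => Sym2.ind hBB e
  have h01 := h (.inr 0) (.inr 1) trivial trivial
  have h12 := h (.inr 1) (.inr 2) trivial trivial
  cases S with
  | three p q r B =>
    cases S' with
    | three p' q' r' B' =>
      have h0 := (h (.inl p) (.inr 0) hS.1 trivial).1 rfl
      have h1 := (h (.inl q) (.inr 1) hS.2.1 trivial).1 rfl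
      have h2 := (h (.inl r) (.inr 2) hS.2.2.1 trivial).1 rfl
      obtain rfl : p = p' := h0
      obtain rfl : q = q' := h1
      obtain rfl : r = r' := h2
      rw [hB B B' h']
    | capL q' B' => simp [Conn] at h01
    | capR q' B' => simp [Conn] at h12
  | capL q B =>
    cases S' with
    | three p' q' r' B' => simp [Conn] at h01
    | capL q' B' =>
      have h2 := (h (.inl q) (.inr 2) hS.1 trivial).1 ⟨rfl, rfl⟩
      obtain rfl : q = q' := h2.2
      rw [hB B B' h']
    | capR q' B' => simp [Conn] at h12
  | capR q B =>
    cases S' with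
    | three p' q' r' B' => simp [Conn] at h12
    | capL q' B' => simp [Conn] at h12
    | capR q' B' =>
      have h0 := (h (.inl q) (.inr 0) hS.1 trivial).1 ⟨rfl, rfl⟩
      obtain rfl : q = q' := h0.2
      rw [hB B B' h']

end Tangle

/-! ### Counting components -/

/-- Imposing one identification after another lowers the number of values by at most one each time.
This is the bound that a graph has at least as many components as vertices minus edges. -/
theorem exists_labelling {V : Type} [Finite V] (E : List (V × V)) :
    ∃ (X : Type) (f : V → X), Finite X ∧ Function.Surjective f ∧ (∀ e ∈ E, f e.1 = f e.2) ∧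
      Nat.card V ≤ Nat.card X + E.length := by
  classical
  induction E with
  | nil => exact ⟨V, id, inferInstance, Function.surjective_id, by simp, by simp⟩
  | cons e E ih =>
    obtain ⟨X, f, hX, hf, hE, hcard⟩ := ih
    by_cases he : f e.1 = f e.2
    · exact ⟨X, f, hX, hf, by simpa [he] using hE, by simp only [List.length_cons]; omega⟩
    · refine ⟨{x // x ≠ f e.2}, fun v => if hv : f v = f e.2 then ⟨f e.1, he⟩ else ⟨f v, hv⟩,
        inferInstance, ?_, ?_, ?_⟩
      · rintro ⟨x, hx⟩
        obtain ⟨v, rfl⟩ := hf x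
        exact ⟨v, by simp [hx]⟩
      · intro e' he'
        rcases List.mem_cons.1 he' with rfl | he'
        · simp [he]
        · simp [hE e' he']
      · have : Nat.card {x // x ≠ f e.2} + 1 = Nat.card X := by
          have := Fintype.ofFinite X
          rw [Nat.card_eq_fintype_card, Nat.card_eq_fintype_card, Fintype.card_subtype_compl,
            Fintype.card_subtype_eq]
          have : 0 < Fintype.card X := Fintype.card_pos_iff.2 ⟨f e.2⟩
          omega
        simp only [List.length_cons]
        omega

/-- If no fibre is a singleton and there are at least half as many values as points, then all
fibres are pairs. -/
theorem fibers_are_pairs {β γ : Type} [Finite β] [Finite γ] (g : β → γ)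
    (hg : ∀ b, ∃ c, c ≠ b ∧ g c = g b) (hcard : Nat.card β ≤ 2 * (Set.range g).ncard) :
    Nat.card β = 2 * (Set.range g).ncard ∧
      ∀ b c d, g c = g b → g d = g b → c ≠ b → d ≠ b → c = d := by
  classical
  have := Fintype.ofFinite β
  have hr : (Set.range g).ncard = (Finset.univ.image g).card := by
    rw [← Set.ncard_coe_finset]; simp
  have hβ : Nat.card β =
      ∑ x ∈ Finset.univ.image g, (Finset.univ.filter fun b => g b = x).card := by
    rw [Nat.card_eq_fintype_card, ← Finset.card_univ,
      Finset.card_eq_sum_card_image g Finset.univ]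
  rw [hr, hβ] at hcard ⊢
  have h2 : ∀ x ∈ Finset.univ.image g, 2 ≤ (Finset.univ.filter fun b => g b = x).card := by
    intro x hx
    obtain ⟨b, -, rfl⟩ := Finset.mem_image.1 hx
    obtain ⟨c, hc, hcb⟩ := hg b
    exact Finset.one_lt_card.2 ⟨c, by simp [hcb], b, by simp, hc⟩
  have hle := Finset.sum_le_sum h2
  have hconst : ∑ _x ∈ Finset.univ.image g, 2 = 2 * (Finset.univ.image g).card := by
    rw [Finset.sum_const, smul_eq_mul, mul_comm]
  rw [hconst] at hle
  refine ⟨le_antisymm hcard hle, ?_⟩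
  intro b c d hc hd hcb hdb
  by_contra hcd
  have hlt := Finset.sum_lt_sum h2 ⟨g b, Finset.mem_image_of_mem g (Finset.mem_univ b),
    Finset.two_lt_card.2 ⟨b, by simp, c, by simp [hc], d, by simp [hd], hcb.symm, hdb.symm, hcd⟩⟩
  rw [hconst] at hlt
  omega

/-! ### Comparison with the smoothing graph -/

/-- The segment of `L(m, 3)` with the given position. -/
def Seg.toSegment (m : ℕ) : Seg → Segment m 3
  | .inl (i, j) => .v (Fin.ofNat (m + 1) i) j
  | .inr (k, j) => if hk : k < m then .h ⟨k, hk⟩ j else .v 0 0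

theorem Seg.toSegment_v {m i : ℕ} (hi : i < m + 1) (j : Fin 3) :
    (v i j).toSegment m = .v ⟨i, hi⟩ j := by
  simp only [toSegment, Segment.v.injEq, and_true]
  exact Fin.ext (Nat.mod_eq_of_lt hi)

theorem Seg.toSegment_h {m k : ℕ} (hk : k < m) (j : Fin 4) :
    (h k j).toSegment m = .h ⟨k, hk⟩ j := by
  simp [toSegment, hk]

/-- The markers of a Kauffman state, extended to infinitely many rows. -/
def KauffmanState.extend {m : ℕ} (s : KauffmanState m 3) (k : ℕ) : Fin 3 → Bool :=
  if hk : k < m then s ⟨k, hk⟩ else fun _ => false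

theorem KauffmanState.extend_of_lt {m : ℕ} (s : KauffmanState m 3) {k : ℕ} (hk : k < m) :
    s.extend k = s ⟨k, hk⟩ := dif_pos hk

theorem joins_of_mem_row {m : ℕ} (s : KauffmanState m 3) {k : ℕ} (hk : k < m) {e : Seg × Seg}
    (he : e ∈ row k (s.extend k)) : Joins s (e.1.toSegment m) (e.2.toSegment m) := by
  have key : ∀ j : Fin 3, e ∈ crossing k j (s ⟨k, hk⟩ j) →
      Joins s (e.1.toSegment m) (e.2.toSegment m) := by
    intro j hj
    have e1 : (v k j).toSegment m = .v (Fin.castSucc ⟨k, hk⟩) j := toSegment_v (by omega) j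
    have e2 : (v (k + 1) j).toSegment m = .v (Fin.succ ⟨k, hk⟩) j := toSegment_v (by omega) j
    have e3 := toSegment_h hk
    cases hb : s ⟨k, hk⟩ j <;> simp only [crossing, hb, if_true, Bool.false_eq_true, if_false,
      List.mem_cons, List.not_mem_nil, or_false] at hj <;> rcases hj with rfl | rfl <;>
      simp only [e1, e2, e3]
    · exact .neg_upper _ _ hb
    · exact .neg_lower _ _ hb
    · exact .pos_upper _ _ hb
    · exact .pos_lower _ _ hb
  rw [s.extend_of_lt hk] at he
  simp only [row, List.mem_append] at he
  rcases he with (he | he) | he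
  exacts [key _ he, key _ he, key _ he]

theorem Joins.exists_mem_row {m : ℕ} {s : KauffmanState m 3} {a b : Segment m 3}
    (hab : Joins s a b) :
    ∃ k < m, ∃ e ∈ row k (s.extend k), e.1.toSegment m = a ∧ e.2.toSegment m = b := by
  have key : ∀ (i : Fin m) (j : Fin 3), ∀ e ∈ crossing i j (s i j), e.1.toSegment m = a →
      e.2.toSegment m = b →
      ∃ k < m, ∃ e ∈ row k (s.extend k), e.1.toSegment m = a ∧ e.2.toSegment m = b := by
    intro i j e he ha hb
    refine ⟨i, i.2, e, crossing_subset_row (c := j) ?_, ha, hb⟩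
    rw [s.extend_of_lt i.2]
    exact he
  have e1 : ∀ (i : Fin m) j, (v i j).toSegment m = .v i.castSucc j :=
    fun i j => toSegment_v (by omega) j
  have e2 : ∀ (i : Fin m) j, (v (i + 1) j).toSegment m = .v i.succ j :=
    fun i j => toSegment_v (by omega) j
  have e3 : ∀ (i : Fin m) j, (h i j).toSegment m = .h i j := fun i j => toSegment_h i.2 j
  cases hab with
  | pos_upper i j hs =>
    exact key i j (v i j, h i j.succ) (by simp [crossing, hs]) (e1 i j) (e3 i _)
  | pos_lower i j hs =>
    exact key i j (h i j.castSucc, v (i + 1) j) (by simp [crossing, hs]) (e3 i _) (e2 i j)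
  | neg_upper i j hs =>
    exact key i j (v i j, h i j.castSucc) (by simp [crossing, hs]) (e1 i j) (e3 i _)
  | neg_lower i j hs =>
    exact key i j (v (i + 1) j, h i j.succ) (by simp [crossing, hs]) (e2 i j) (e3 i _)

/-- The point on the ceiling or the sides, or on the floor, which a boundary point is. -/
def BdryPt.toEnd {m : ℕ} : BdryPt m 3 → Pt ⊕ Fin 3
  | .x j => .inl (.x j)
  | .x' j => .inr j
  | .y i => .inl (.y i)
  | .y' i => .inl (.y' i)

theorem BdryPt.toEnd_injective {m : ℕ} : Function.Injective (BdryPt.toEnd (m := m)) := by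
  intro p q hpq
  cases p <;> cases q <;> simp_all [BdryPt.toEnd, Fin.ext_iff]

theorem BdryPt.exists_toEnd_eq {m : ℕ} {a : Pt ⊕ Fin 3} (ha : Tangle.EndInRows m a) :
    ∃ p : BdryPt m 3, p.toEnd = a :=
  match a, ha with
  | .inl (.x j), _ => ⟨.x j, rfl⟩
  | .inl (.y k), hk => ⟨.y ⟨k, hk⟩, rfl⟩
  | .inl (.y' k), hk => ⟨.y' ⟨k, hk⟩, rfl⟩
  | .inr j, _ => ⟨.x' j, rfl⟩

theorem BdryPt.endInRows_toEnd {m : ℕ} (p : BdryPt m 3) : Tangle.EndInRows m p.toEnd := by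
  cases p with
  | x j => exact trivial
  | x' j => exact trivial
  | y i => exact i.2
  | y' i => exact i.2

theorem BdryPt.toSegment_endSeg {m : ℕ} (p : BdryPt m 3) :
    (Tangle.endSeg m p.toEnd).toSegment m = p.segment := by
  cases p with
  | x j => exact toSegment_v (Nat.succ_pos m) j
  | x' j => exact toSegment_v (Nat.lt_succ_self m) j
  | y i => exact toSegment_h i.2 0
  | y' i => exact toSegment_h i.2 3

theorem card_bdryPt (m : ℕ) : Nat.card (BdryPt m 3) = 2 * (m + 3) := by
  let e : BdryPt m 3 ≃ (Fin 3 ⊕ Fin 3) ⊕ (Fin m ⊕ Fin m) :=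
    { toFun := fun p => match p with
        | .x j => .inl (.inl j)
        | .x' j => .inl (.inr j)
        | .y i => .inr (.inl i)
        | .y' i => .inr (.inr i)
      invFun := fun p => match p with
        | .inl (.inl j) => .x j
        | .inl (.inr j) => .x' j
        | .inr (.inl i) => .y i
        | .inr (.inr i) => .y' i
      left_inv := by rintro (_ | _ | _ | _) <;> rfl
      right_inv := by rintro ((_ | _) | (_ | _)) <;> rfl }
  rw [Nat.card_congr e]
  simp
  omega

theorem card_segment (m : ℕ) : Nat.card (Segment m 3) = (m + 1) * 3 + m * 4 := by
  let e : Segment m 3 ≃ (Fin (m + 1) × Fin 3) ⊕ (Fin m × Fin 4) :=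
    { toFun := fun p => match p with
        | .v i j => .inl (i, j)
        | .h i j => .inr (i, j)
      invFun := fun p => match p with
        | .inl (i, j) => .v i j
        | .inr (i, j) => .h i j
      left_inv := by rintro (_ | _) <;> rfl
      right_inv := by rintro (_ | _) <;> rfl }
  rw [Nat.card_congr e]
  simp

theorem eq_of_reachable {V X : Type} {G : SimpleGraph V} {f : V → X}
    (hf : ∀ a b, G.Adj a b → f a = f b) {a b : V} (hab : G.Reachable a b) : f a = f b := by
  obtain ⟨p⟩ := hab
  induction p with
  | nil => rfl
  | cons hadj _ ih => exact (hf _ _ hadj).trans ih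

/-- An Euler characteristic count. Let n be the number of loops found by the transfer. Counting
generators gives at least m + 3 + n components. Every component meeting the boundary contains two of
the 2(m + 3) boundary points, so there are at most m + 3 of these, and the remaining ones are
covered by n representatives. Equality must hold throughout, so boundary components contain exactly
two boundary points, and these are the pairs joined by the tangle. -/
theorem components_of_smoothing {m : ℕ} (s : KauffmanState m 3) :
    closedComponents s = Tangle.runLoops s.extend m ∧
      ∀ p q : BdryPt m 3, (Tangle.run s.extend m).Conn p.toEnd q.toEnd ↔
        p ≠ q ∧ (smoothing s).Reachable p.segment q.segment := by
  classical
  obtain ⟨E, reps, hE, hreps, hsub, hlab⟩ := Tangle.exists_generators s.extend m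
  have hvalid := Tangle.valid_run s.extend m
  set S := Tangle.run s.extend m with hS
  set n := Tangle.runLoops s.extend m with hn
  set comp : Segment m 3 → (smoothing s).ConnectedComponent :=
    (smoothing s).connectedComponentMk with hcomp
  have hjoins : ∀ a b, Joins s a b → comp a = comp b := by
    intro a b hab
    by_cases h : a = b
    · rw [h]
    · exact SimpleGraph.ConnectedComponent.sound
        (SimpleGraph.Adj.reachable ((SimpleGraph.fromRel_adj _ _ _).2 ⟨h, Or.inl hab⟩))
  obtain ⟨-, hlabel, hv, hh⟩ := hlab _ (fun σ => comp (σ.toSegment m)) (by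
    intro e he
    obtain ⟨k, hk, hke⟩ := hsub e he
    exact hjoins _ _ (joins_of_mem_row s hk hke))
  -- the number of all components
  have hcount : m + 3 + n ≤ Nat.card (smoothing s).ConnectedComponent := by
    obtain ⟨X, f, hX, hf, hfE, hcard⟩ :=
      exists_labelling (E.map fun e => (e.1.toSegment m, e.2.toSegment m))
    obtain ⟨hrows, -⟩ := hlab X (fun σ => f (σ.toSegment m)) (by
      intro e he
      exact hfE _ (List.mem_map_of_mem (f := fun e => (e.1.toSegment m, e.2.toSegment m)) he))
    have hfJ : ∀ a b, Joins s a b → f a = f b := by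
      intro a b hab
      obtain ⟨k, hk, e, he, rfl, rfl⟩ := hab.exists_mem_row
      exact hrows k hk e he
    have hfadj : ∀ a b, (smoothing s).Adj a b → f a = f b := by
      intro a b hab
      rcases ((SimpleGraph.fromRel_adj _ _ _).1 hab).2 with h | h
      · exact hfJ a b h
      · exact (hfJ b a h).symm
    have hle : Nat.card X ≤ Nat.card (smoothing s).ConnectedComponent := by
      refine Nat.card_le_card_of_injective (fun x : X => comp (Function.surjInv hf x)) ?_
      intro x x' hxx
      have := eq_of_reachable hfadj (SimpleGraph.ConnectedComponent.exact hxx)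
      rwa [Function.surjInv_eq hf, Function.surjInv_eq hf] at this
    -- There are 7m + 3 segments and 6m - n identifications.
    rw [card_segment, List.length_map] at hcard
    omega
  set g : BdryPt m 3 → (smoothing s).ConnectedComponent := fun p => comp p.segment with hg
  have hconn : ∀ p q : BdryPt m 3, S.Conn p.toEnd q.toEnd → g p = g q := by
    intro p q hpq
    have := hlabel.conn hpq
    simpa only [BdryPt.toSegment_endSeg] using this
  have hpartner : ∀ p : BdryPt m 3, ∃ q, S.Conn p.toEnd q.toEnd ∧ q ≠ p := by
    intro p
    obtain ⟨b, hb, hab⟩ := hvalid.exists_conn p.endInRows_toEnd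
    obtain ⟨q, rfl⟩ := BdryPt.exists_toEnd_eq hb
    exact ⟨q, hab, fun h => hvalid.conn_ne hab (h ▸ rfl)⟩
  -- every component contains a boundary point or one of the representatives
  have hreach : ∀ c : (smoothing s).ConnectedComponent,
      c ∈ Set.range g ∨ ∃ r ∈ reps, comp (r.toSegment m) = c := by
    intro c
    obtain ⟨a, rfl⟩ := Quot.exists_rep c
    have key : ∀ σ : Seg, Tangle.Reaches (fun σ => comp (σ.toSegment m)) m reps σ →
        comp (σ.toSegment m) ∈ Set.range g ∨
          ∃ r ∈ reps, comp (r.toSegment m) = comp (σ.toSegment m) := by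
      have hend : ∀ a : Pt ⊕ Fin 3, Tangle.EndInRows m a →
          comp ((Tangle.endSeg m a).toSegment m) ∈ Set.range g := by
        intro a ha
        obtain ⟨p, rfl⟩ := BdryPt.exists_toEnd_eq ha
        exact ⟨p, by simp only [hg, BdryPt.toSegment_endSeg]⟩
      rintro σ (⟨p, hp, h⟩ | ⟨j, h⟩ | ⟨r, hr, h⟩)
      · left; simp only at h; rw [h]; exact hend (.inl p) hp
      · left; simp only at h; rw [h]; exact hend (.inr j) trivial
      · exact Or.inr ⟨r, hr, h.symm⟩
    cases a with
    | v i j =>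
      have := key _ (hv i (Nat.lt_succ_iff.1 i.2) j)
      rwa [toSegment_v i.2] at this
    | h i j =>
      have := key _ (hh i i.2 j)
      rwa [toSegment_h i.2] at this
  have hclosed : closedComponents s = ((Set.range g)ᶜ).ncard := by
    rw [closedComponents, ← Nat.card_coe_set_eq]
    refine Nat.card_congr (Equiv.subtypeEquivRight fun c => ?_)
    simp [hg, hcomp]
  have hsum : (Set.range g).ncard + ((Set.range g)ᶜ).ncard =
      Nat.card (smoothing s).ConnectedComponent := Set.ncard_add_ncard_compl _
  have hle : ((Set.range g)ᶜ).ncard ≤ n := by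
    have hsubset : (Set.range g)ᶜ ⊆
        ((reps.map fun r => comp (r.toSegment m)).toFinset : Set _) := by
      intro c hc
      rcases hreach c with h | ⟨r, hr, h⟩
      · exact absurd h hc
      · simp only [List.coe_toFinset, Set.mem_ofPred_eq, List.mem_map]
        exact ⟨r, hr, h⟩
    calc ((Set.range g)ᶜ).ncard ≤ _ := Set.ncard_le_ncard hsubset (Finset.finite_toSet _)
      _ = _ := Set.ncard_coe_finset _
      _ ≤ _ := List.toFinset_card_le _
      _ = n := by rw [List.length_map, hreps]
  -- At most n components miss the boundary, so at least m + 3 meet it, half the number of boundary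
  -- points.
  obtain ⟨hcard, hpair⟩ := fibers_are_pairs g
    (fun p => (hpartner p).imp fun q hq => ⟨hq.2, (hconn p q hq.1).symm⟩)
    (by rw [card_bdryPt]; omega)
  rw [card_bdryPt] at hcard
  refine ⟨by omega, fun p q => ⟨fun hpq => ⟨?_, ?_⟩, ?_⟩⟩
  · rintro rfl
    exact hvalid.conn_ne hpq rfl
  · exact SimpleGraph.ConnectedComponent.exact (hconn p q hpq)
  · rintro ⟨hne, hreachable⟩
    obtain ⟨r, hr, hrp⟩ := hpartner p
    rwa [hpair p q r (SimpleGraph.ConnectedComponent.sound hreachable).symm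
      (hconn p r hr).symm hne.symm hrp]

/-- A Catalan state and a valid tangle carry the same connection data, so the Kauffman states
realizing `C` form a single fibre of `run`. -/
theorem Realizes.iff_run_eq {m : ℕ} {s s₀ : KauffmanState m 3} {C : CatalanState m 3}
    (h₀ : Realizes s₀ C) :
    Realizes s C ↔ Tangle.run s.extend m = Tangle.run s₀.extend m := by
  have hs := (components_of_smoothing s).2
  have hs₀ := (components_of_smoothing s₀).2
  constructor
  · intro h
    refine Tangle.eq_of_conn_iff (Tangle.valid_run _ m) (Tangle.valid_run _ m) ?_
    intro a b ha hb
    obtain ⟨p, rfl⟩ := BdryPt.exists_toEnd_eq ha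
    obtain ⟨q, rfl⟩ := BdryPt.exists_toEnd_eq hb
    rw [hs, hs₀, ← h p q, ← h₀ p q]
  · intro h p q
    rw [h₀ p q, ← hs₀, ← h, hs]

end Topology

/-! ### State sums and the effect of one row -/

open LaurentPolynomial

theorem sum_markers {M : Type*} [AddCommMonoid M] (F : (Fin 3 → Bool) → M) :
    ∑ w, F w = F ![false, false, false] + F ![true, true, true] + F ![false, true, true] +
      F ![false, false, true] + F ![true, false, false] + F ![true, true, false] +
      F ![true, false, true] + F ![false, true, false] := by
  have h : (Finset.univ : Finset (Fin 3 → Bool)) = {![false, false, false], ![true, true, true],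
      ![false, true, true], ![false, false, true], ![true, false, false], ![true, true, false],
      ![true, false, true], ![false, true, false]} := by decide
  rw [h]
  repeat rw [Finset.sum_insert (by decide)]
  rw [Finset.sum_singleton]
  simp only [add_assoc]

namespace Tangle

theorem run_congr {s s' : ℕ → Fin 3 → Bool} {i : ℕ} (h : ∀ k < i, s k = s' k) :
    run s i = run s' i ∧ runLoops s i = runLoops s' i := by
  induction i with
  | zero => exact ⟨rfl, rfl⟩
  | succ i ih =>
    obtain ⟨h1, h2⟩ := ih fun k hk => h k (by omega)
    have h3 := h i (Nat.lt_succ_self i)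
    simp only [run, runLoops, h1, h2, h3, and_self]

/-- The number of positive minus the number of negative markers in a row. -/
def markerSum (w : Fin 3 → Bool) : ℤ := ∑ j, if w j = true then 1 else -1

/-- The factor of a closed component. -/
noncomputable def loopValue : ℤ[T;T⁻¹] := -T 2 - T (-2)

/-- The contribution of a Kauffman state to the state sum. -/
noncomputable def weight {m : ℕ} (s : KauffmanState m 3) : ℤ[T;T⁻¹] :=
  T (∑ i, markerSum (s i)) * loopValue ^ runLoops s.extend m

/-- The state sum of `L(m, 3)`, evaluated by a function of tangles. -/
noncomputable def stateSum (m : ℕ) (φ : Tangle → ℤ[T;T⁻¹]) : ℤ[T;T⁻¹] :=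
  ∑ s : KauffmanState m 3, weight s * φ (run s.extend m)

/-- The sum over the smoothings of a row added to a tangle, evaluated by a function of tangles. -/
noncomputable def rowSum (m : ℕ) (φ : Tangle → ℤ[T;T⁻¹]) (S : Tangle) : ℤ[T;T⁻¹] :=
  ∑ w : Fin 3 → Bool, T (markerSum w) * loopValue ^ loops w S * φ (step m w S)

theorem extend_snoc {m : ℕ} (s : KauffmanState m 3) (w : Fin 3 → Bool) :
    (∀ k < m, KauffmanState.extend (m := m + 1)
      (Fin.snoc (α := fun _ => Fin 3 → Bool) s w) k = s.extend k) ∧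
    KauffmanState.extend (m := m + 1) (Fin.snoc (α := fun _ => Fin 3 → Bool) s w) m = w := by
  constructor
  · intro k hk
    rw [KauffmanState.extend_of_lt _ hk, KauffmanState.extend_of_lt _ (by omega : k < m + 1)]
    exact Fin.snoc_castSucc (α := fun _ => Fin 3 → Bool) w s ⟨k, hk⟩
  · rw [KauffmanState.extend_of_lt _ (Nat.lt_succ_self m)]
    exact Fin.snoc_last (α := fun _ => Fin 3 → Bool) w s

/-- The last row is split off and its smoothings are summed first, so the row acts as the transpose
of a transfer operator on evaluations `φ`. Identities between state sums thereby reduce to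
identities for one tangle and one row. -/
theorem stateSum_succ (m : ℕ) (φ : Tangle → ℤ[T;T⁻¹]) :
    stateSum (m + 1) φ = stateSum m (rowSum m φ) := by
  unfold stateSum rowSum
  rw [← (Fin.snocEquiv fun _ : Fin (m + 1) => Fin 3 → Bool).sum_comp, Fintype.sum_prod_type,
    Finset.sum_comm]
  refine Finset.sum_congr rfl fun s _ => ?_
  rw [Finset.mul_sum]
  refine Finset.sum_congr rfl fun w _ => ?_
  have hs := extend_snoc s w
  have hrun := run_congr hs.1
  change weight (m := m + 1) (Fin.snoc (α := fun _ => Fin 3 → Bool) s w) * φ (run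
    (KauffmanState.extend (m := m + 1) (Fin.snoc (α := fun _ => Fin 3 → Bool) s w)) (m + 1)) = _
  simp only [weight, run, runLoops, hs.2, hrun.1, hrun.2, Fin.sum_univ_castSucc,
    Fin.snoc_castSucc, Fin.snoc_last, T_add, pow_add]
  ring

theorem stateSum_congr {m : ℕ} {φ ψ : Tangle → ℤ[T;T⁻¹]}
    (h : ∀ S : Tangle, S.Valid m → φ S = ψ S) : stateSum m φ = stateSum m ψ :=
  Finset.sum_congr rfl fun s _ => by rw [h _ (valid_run _ m)]

theorem stateSum_add (m : ℕ) (φ ψ : Tangle → ℤ[T;T⁻¹]) :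
    stateSum m (fun S => φ S + ψ S) = stateSum m φ + stateSum m ψ := by
  simp only [stateSum, mul_add, Finset.sum_add_distrib]

theorem stateSum_mul (m : ℕ) (c : ℤ[T;T⁻¹]) (φ : Tangle → ℤ[T;T⁻¹]) :
    stateSum m (fun S => c * φ S) = c * stateSum m φ := by
  simp only [stateSum, Finset.mul_sum]
  exact Finset.sum_congr rfl fun s _ => by ring

theorem stateSum_zero (φ : Tangle → ℤ[T;T⁻¹]) : stateSum 0 φ = φ init := by
  rw [stateSum, Fintype.sum_unique]
  simp [weight, run, runLoops]

theorem rowSum_three (m : ℕ) (φ : Tangle → ℤ[T;T⁻¹]) (p q r : Pt) (B : Set (Sym2 Pt)) :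
    rowSum m φ (three p q r B) =
      T (-3) * φ (three q r (.y' m) (insert s(p, .y m) B)) +
      T 3 * φ (three (.y m) p q (insert s(r, .y' m) B)) +
      T 1 * φ (capL q (insert s(p, .y m) (insert s(r, .y' m) B))) +
      T (-1) * φ (capR q (insert s(p, .y m) (insert s(r, .y' m) B))) +
      T (-1) * φ (three (.y m) r (.y' m) (insert s(p, q) B)) +
      T 1 * φ (three (.y m) p (.y' m) (insert s(q, r) B)) +
      T 1 * φ (capR (.y m) (insert s(r, .y' m) (insert s(p, q) B))) +
      T (-1) * φ (capL (.y' m) (insert s(p, .y m) (insert s(q, r) B))) := by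
  rw [rowSum, sum_markers]
  simp [markerSum, Fin.sum_univ_three, loops, step]

theorem T_two_eq : (T 2 : ℤ[T;T⁻¹]) = T 1 ^ 2 := by rw [T_pow]; norm_num
theorem T_neg_two_eq : (T (-2) : ℤ[T;T⁻¹]) = T (-1) ^ 2 := by rw [T_pow]; norm_num
theorem T_three_eq : (T 3 : ℤ[T;T⁻¹]) = T 1 ^ 3 := by rw [T_pow]; norm_num
theorem T_neg_three_eq : (T (-3) : ℤ[T;T⁻¹]) = T (-1) ^ 3 := by rw [T_pow]; norm_num
theorem T_one_mul_T_neg_one : (T 1 * T (-1) : ℤ[T;T⁻¹]) = 1 := by rw [← T_add]; simp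

/-- The second Reidemeister move: a cap can be moved off a row. -/
theorem rowSum_capL (m : ℕ) (φ : Tangle → ℤ[T;T⁻¹]) (q : Pt) (B : Set (Sym2 Pt)) :
    rowSum m φ (capL q B) = T 1 * φ (capL (.y m) (insert s(q, .y' m) B)) +
      T (-1) * φ (capL (.y' m) (insert s(q, .y m) B)) := by
  rw [rowSum, sum_markers]
  simp [markerSum, Fin.sum_univ_three, loops, step, loopValue]
  rw [T_two_eq, T_neg_two_eq, T_three_eq, T_neg_three_eq]
  generalize φ (three (.y m) q (.y' m) B) = X
  generalize φ (capR (.y m) (insert s(q, .y' m) B)) = Y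
  have h := T_one_mul_T_neg_one
  -- Both unwanted tangles cancel: `X` has coefficient A⁻³ + A + A⁻¹(-A² - A⁻²), and `Y` has A³ +
  -- A⁻¹ + A(-A² - A⁻²).
  linear_combination (-T (-1) * Y - T 1 * X) * h

theorem rowSum_capR (m : ℕ) (φ : Tangle → ℤ[T;T⁻¹]) (q : Pt) (B : Set (Sym2 Pt)) :
    rowSum m φ (capR q B) = T 1 * φ (capR (.y m) (insert s(q, .y' m) B)) +
      T (-1) * φ (capR (.y' m) (insert s(q, .y m) B)) := by
  rw [rowSum, sum_markers]
  simp [markerSum, Fin.sum_univ_three, loops, step, loopValue]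
  rw [T_two_eq, T_neg_two_eq, T_three_eq, T_neg_three_eq]
  generalize φ (three (.y m) q (.y' m) B) = X
  generalize φ (capL (.y' m) (insert s(q, .y m) B)) = Y
  have h := T_one_mul_T_neg_one
  linear_combination (-T 1 * Y - T (-1) * X) * h

end Tangle

/-! ### Classes of tangles and their recursion along a row -/

/-- No arc ends in the point. -/
def Fresh (z : Pt) (B : Set (Sym2 Pt)) : Prop := ∀ u, s(z, u) ∉ B

theorem Fresh.insert {z : Pt} {B : Set (Sym2 Pt)} (h : Fresh z B) {a b : Pt} (ha : a ≠ z)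
    (hb : b ≠ z) : Fresh z (insert s(a, b) B) := by
  rintro u (hu | hu)
  · rw [Sym2.eq_iff] at hu
    rcases hu with ⟨rfl, -⟩ | ⟨rfl, -⟩
    · exact ha rfl
    · exact hb rfl
  · exact h u hu

theorem ArcsIn.fresh_y {m : ℕ} {B : Set (Sym2 Pt)} (h : ArcsIn m B) : Fresh (.y m) B :=
  fun u hu => Tangle.ne_y (h _ u hu).1 rfl

theorem ArcsIn.fresh_y' {m : ℕ} {B : Set (Sym2 Pt)} (h : ArcsIn m B) : Fresh (.y' m) B :=
  fun u hu => Tangle.ne_y' (h _ u hu).1 rfl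

/-- The arc ending in a new boundary point can be read off and removed again. This makes the
predecessor of a tangle under a given smoothing unique. -/
theorem insert_eq_insert_iff_of_fresh {z a b : Pt} {B B' : Set (Sym2 Pt)} (hB : Fresh z B)
    (hB' : Fresh z B') : insert s(a, z) B = insert s(b, z) B' ↔ a = b ∧ B = B' := by
  constructor
  · intro h
    have hab : a = b := by
      have h1 : s(a, z) ∈ insert s(b, z) B' := h ▸ Set.mem_insert _ _
      rcases h1 with h1 | h1
      · exact Sym2.congr_left.1 h1
      · exact absurd (Sym2.eq_swap ▸ h1) (hB' a)
    subst hab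
    refine ⟨rfl, ?_⟩
    have h1 : s(a, z) ∉ B := fun h1 => hB a (Sym2.eq_swap ▸ h1)
    have h2 : s(a, z) ∉ B' := fun h2 => hB' a (Sym2.eq_swap ▸ h2)
    rw [← Set.insert_sdiff_self_of_notMem h1, h, Set.insert_sdiff_self_of_notMem h2]
  · rintro ⟨rfl, rfl⟩
    rfl

namespace Tangle

open Classical in
/-- The indicator of a proposition. -/
noncomputable def ind (P : Prop) : ℤ[T;T⁻¹] := if P then 1 else 0

theorem ind_true : ind True = 1 := if_pos trivial
theorem ind_false : ind False = 0 := if_neg id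

/-- Joining the first two points of the floor of the tangle gives arcs `B` and a strand ending in
`q`. -/
def ClosesLeft (q : Pt) (B : Set (Sym2 Pt)) : Tangle → Prop
  | three a b c B' => c = q ∧ insert s(a, b) B' = B
  | _ => False

/-- Joining the last two points of the floor of the tangle gives arcs `B` and a strand ending in
`q`. -/
def ClosesRight (q : Pt) (B : Set (Sym2 Pt)) : Tangle → Prop
  | three a b c B' => a = q ∧ insert s(b, c) B' = B
  | _ => False

/-- The tangle occurs among the smoothings of the first `m` rows. -/
def Occurs (m : ℕ) (S : Tangle) : Prop := ∃ s : ℕ → Fin 3 → Bool, run s m = S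

/-- The state sums over, and the occurrence of, the tangles which become a given set of arcs and a
single strand when two neighbouring points of the floor are joined. -/
structure ClassData : Type where
  capL : ℤ[T;T⁻¹]
  capR : ℤ[T;T⁻¹]
  left : ℤ[T;T⁻¹]
  right : ℤ[T;T⁻¹]
  hasCapL : Prop
  hasCapR : Prop
  hasLeft : Prop
  hasRight : Prop

/-- Reflection in a vertical line. -/
def ClassData.mirror (D : ClassData) : ClassData :=
  ⟨D.capR, D.capL, D.right, D.left, D.hasCapR, D.hasCapL, D.hasRight, D.hasLeft⟩

/-- The class of tangles with arcs `B` and a strand ending in `q`. -/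
noncomputable def classData (m : ℕ) (q : Pt) (B : Set (Sym2 Pt)) : ClassData where
  capL := stateSum m fun S => ind (S = capL q B)
  capR := stateSum m fun S => ind (S = capR q B)
  left := stateSum m fun S => ind (S.ClosesLeft q B)
  right := stateSum m fun S => ind (S.ClosesRight q B)
  hasCapL := Occurs m (capL q B)
  hasCapR := Occurs m (capR q B)
  hasLeft := ∃ S, Occurs m S ∧ S.ClosesLeft q B
  hasRight := ∃ S, Occurs m S ∧ S.ClosesRight q B

/-- The transition between classes along a row, up to the unit `τ` and reflection. -/
structure ClassData.Step (τ : ℤ[T;T⁻¹]) (D D' : ClassData) : Prop where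
  capL : D'.capL = τ * D.capL
  capR : D'.capR = τ * (D.capR + D.left)
  left : D'.left = 0
  right : D'.right = τ * (D.right + (T 2 + T (-2)) * D.left)
  hasCapL : D'.hasCapL → D.hasCapL
  hasCapR : D'.hasCapR → D.hasCapL ∨ D.hasCapR ∨ D.hasLeft
  hasLeft : ¬ D'.hasLeft

theorem stateSum_succ_congr {m : ℕ} {φ ψ : Tangle → ℤ[T;T⁻¹]}
    (h : ∀ S : Tangle, S.Valid m → rowSum m φ S = ψ S) :
    stateSum (m + 1) φ = stateSum m ψ := by
  rw [stateSum_succ]; exact stateSum_congr h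

theorem Occurs.valid {m : ℕ} {S : Tangle} (h : Occurs m S) : S.Valid m := by
  obtain ⟨s, rfl⟩ := h
  exact valid_run s m

theorem Occurs.exists_step {m : ℕ} {S : Tangle} (h : Occurs (m + 1) S) :
    ∃ S' w, Occurs m S' ∧ S = step m w S' := by
  obtain ⟨s, rfl⟩ := h
  exact ⟨run s m, s m, ⟨s, rfl⟩, rfl⟩

/-- The strand leaves to the right and restarts at the left side. Cap tangles contribute as in the
Reidemeister move. A three-strand tangle whose left floor pair closes up reaches the new right class
by two smoothings, with total weight A³ + A⁻¹ = A(A² + A⁻²); the one whose right pair closes up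
reaches it by a single smoothing of weight A. -/
theorem classData_step_right {m : ℕ} {q : Pt} {B : Set (Sym2 Pt)} (hq : q.InRows m)
    (hB : ArcsIn m B) :
    (classData m q B).Step (T 1) (classData (m + 1) (.y m) (insert s(q, .y' m) B)) := by
  have fB := hB.fresh_y'
  have key : ∀ (c : Pt) (B' : Set (Sym2 Pt)), ArcsIn m B' →
      (insert s(c, .y' m) B' = insert s(q, .y' m) B ↔ c = q ∧ B' = B) :=
    fun c B' h => insert_eq_insert_iff_of_fresh h.fresh_y' fB
  have key2 : ∀ (a b c : Pt) (B' : Set (Sym2 Pt)), a.InRows m → b.InRows m → ArcsIn m B' →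
      (insert s(c, .y' m) (insert s(a, b) B') = insert s(q, .y' m) B ↔
        c = q ∧ insert s(a, b) B' = B) :=
    fun a b c B' ha hb h =>
      insert_eq_insert_iff_of_fresh (h.fresh_y'.insert (ne_y' ha) (ne_y' hb)) fB
  constructor
  · simp only [classData]
    rw [← stateSum_mul]
    refine stateSum_succ_congr fun S hS => ?_
    cases S with
    | three a b c B' =>
      obtain ⟨ha, hb, hc, -, -, -, hB', -⟩ := hS
      simp [rowSum_three, ind_false, ne_y hb]
    | capL a B' =>
      obtain ⟨ha, hB', -⟩ := hS
      simp [rowSum_capL, ind_false, key _ _ hB']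
    | capR a B' => simp [rowSum_capR, ind_false]
  · simp only [classData]
    rw [← stateSum_add, ← stateSum_mul]
    refine stateSum_succ_congr fun S hS => ?_
    cases S with
    | three a b c B' =>
      obtain ⟨ha, hb, hc, -, -, -, hB', -⟩ := hS
      simp [rowSum_three, ind_false, ne_y hb, key2 _ _ _ _ ha hb hB', ClosesLeft]
    | capL a B' => simp [rowSum_capL, ind_false, ClosesLeft]
    | capR a B' =>
      obtain ⟨ha, hB', -⟩ := hS
      simp [rowSum_capR, ind_false, key _ _ hB', ClosesLeft]
  · simp only [classData]
    -- Zero is written as a scaled state sum so that the comparison can be made tangle by tangle. No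
    -- smoothing puts `.y m` at the third floor point.
    rw [← mul_zero (T 1 : ℤ[T;T⁻¹]), ← zero_mul (stateSum m fun _ => 0), ← stateSum_mul,
      ← stateSum_mul]
    refine stateSum_succ_congr fun S hS => ?_
    cases S with
    | three a b c B' =>
      obtain ⟨ha, hb, hc, -, -, -, hB', -⟩ := hS
      simp [rowSum_three, ind_false, ne_y hb, ClosesLeft]
    | capL a B' => simp [rowSum_capL, ind_false, ClosesLeft]
    | capR a B' => simp [rowSum_capR, ind_false, ClosesLeft]
  · simp only [classData]
    rw [← stateSum_mul, ← stateSum_add, ← stateSum_mul]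
    refine stateSum_succ_congr fun S hS => ?_
    cases S with
    | three a b c B' =>
      obtain ⟨ha, hb, hc, -, -, -, hB', -⟩ := hS
      have hcomm := Set.insert_comm s(a, b) s(c, Pt.y' m) B'
      simp [rowSum_three, ind_false, ne_y hb, ClosesLeft, ClosesRight, hcomm,
        key2 _ _ _ _ ha hb hB', key2 _ _ _ _ hb hc hB']
      rw [T_two_eq, T_neg_two_eq, T_three_eq]
      linear_combination (-T (-1) * ind (c = q ∧ insert s(a, b) B' = B)) * T_one_mul_T_neg_one
    | capL a B' => simp [rowSum_capL, ind_false, ClosesLeft, ClosesRight]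
    | capR a B' => simp [rowSum_capR, ind_false, ClosesLeft, ClosesRight]
  · intro h
    obtain ⟨S, w, hS, h⟩ := h.exists_step
    have hv := hS.valid
    cases S with
    | three a b c B' =>
      obtain ⟨ha, hb, hc, -, -, -, hB', -⟩ := hv
      rcases h0 : w 0 <;> rcases h1 : w 1 <;> rcases h2 : w 2 <;>
        simp [step, h0, h1, h2, (ne_y hb).symm] at h
    | capL a B' =>
      obtain ⟨ha, hB', -⟩ := hv
      rcases h0 : w 0 <;> rcases h1 : w 1 <;> rcases h2 : w 2 <;>
        simp [step, h0, h1, h2] at h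
      obtain ⟨rfl, rfl⟩ := (key _ _ hB').1 h.symm
      exact hS
    | capR a B' =>
      rcases h0 : w 0 <;> rcases h1 : w 1 <;> rcases h2 : w 2 <;>
        simp [step, h0, h1, h2] at h
  · intro h
    obtain ⟨S, w, hS, h⟩ := h.exists_step
    have hv := hS.valid
    cases S with
    | three a b c B' =>
      obtain ⟨ha, hb, hc, -, -, -, hB', -⟩ := hv
      rcases h0 : w 0 <;> rcases h1 : w 1 <;> rcases h2 : w 2 <;>
        simp [step, h0, h1, h2, (ne_y hb).symm] at h
      exact Or.inr (Or.inr ⟨_, hS, (key2 _ _ _ _ ha hb hB').1 h.symm⟩)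
    | capL a B' =>
      obtain ⟨ha, hB', -⟩ := hv
      -- Individual smoothings do turn a left cap into a right cap; only their sum vanishes.
      -- Occurrence therefore has a case that the identity for the sums lacks.
      left
      rcases h0 : w 0 <;> rcases h1 : w 1 <;> rcases h2 : w 2 <;>
        simp [step, h0, h1, h2] at h <;>
        (obtain ⟨rfl, rfl⟩ := (key _ _ hB').1 h.symm; exact hS)
    | capR a B' =>
      obtain ⟨ha, hB', -⟩ := hv
      right; left
      rcases h0 : w 0 <;> rcases h1 : w 1 <;> rcases h2 : w 2 <;>
        simp [step, h0, h1, h2] at h <;>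
        (obtain ⟨rfl, rfl⟩ := (key _ _ hB').1 h.symm; exact hS)
  · rintro ⟨S', hS', h⟩
    obtain ⟨S, w, hS, rfl⟩ := hS'.exists_step
    have hv := hS.valid
    cases S with
    | three a b c B' =>
      obtain ⟨ha, hb, hc, -, -, -, hB', -⟩ := hv
      rcases h0 : w 0 <;> rcases h1 : w 1 <;> rcases h2 : w 2 <;>
        simp [step, h0, h1, h2, ClosesLeft, ne_y hb] at h
    | capL a B' =>
      rcases h0 : w 0 <;> rcases h1 : w 1 <;> rcases h2 : w 2 <;>
        simp [step, h0, h1, h2, ClosesLeft] at h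
    | capR a B' =>
      rcases h0 : w 0 <;> rcases h1 : w 1 <;> rcases h2 : w 2 <;>
        simp [step, h0, h1, h2, ClosesLeft] at h

/-- The mirror image of `classData_step_right`: reflection exchanges positive and negative markers,
hence A and A⁻¹, and leaves A² + A⁻² unchanged. -/
theorem classData_step_left {m : ℕ} {q : Pt} {B : Set (Sym2 Pt)} (hq : q.InRows m)
    (hB : ArcsIn m B) :
    (classData m q B).mirror.Step (T (-1))
      (classData (m + 1) (.y' m) (insert s(q, .y m) B)).mirror := by
  have fB := hB.fresh_y
  have key : ∀ (c : Pt) (B' : Set (Sym2 Pt)), ArcsIn m B' →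
      (insert s(c, .y m) B' = insert s(q, .y m) B ↔ c = q ∧ B' = B) :=
    fun c B' h => insert_eq_insert_iff_of_fresh h.fresh_y fB
  have key2 : ∀ (a b c : Pt) (B' : Set (Sym2 Pt)), a.InRows m → b.InRows m → ArcsIn m B' →
      (insert s(c, .y m) (insert s(a, b) B') = insert s(q, .y m) B ↔
        c = q ∧ insert s(a, b) B' = B) :=
    fun a b c B' ha hb h =>
      insert_eq_insert_iff_of_fresh (h.fresh_y.insert (ne_y ha) (ne_y hb)) fB
  constructor
  · simp only [classData, ClassData.mirror]
    rw [← stateSum_mul]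
    refine stateSum_succ_congr fun S hS => ?_
    cases S with
    | three a b c B' =>
      obtain ⟨ha, hb, hc, -, -, -, hB', -⟩ := hS
      simp [rowSum_three, ind_false, ne_y' hb]
    | capR a B' =>
      obtain ⟨ha, hB', -⟩ := hS
      simp [rowSum_capR, ind_false, key _ _ hB']
    | capL a B' => simp [rowSum_capL, ind_false]
  · simp only [classData, ClassData.mirror]
    rw [← stateSum_add, ← stateSum_mul]
    refine stateSum_succ_congr fun S hS => ?_
    cases S with
    | three a b c B' =>
      obtain ⟨ha, hb, hc, -, -, -, hB', -⟩ := hS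
      simp [rowSum_three, ind_false, ne_y' hb, key2 _ _ _ _ hb hc hB', ClosesRight]
    | capR a B' => simp [rowSum_capR, ind_false, ClosesRight]
    | capL a B' =>
      obtain ⟨ha, hB', -⟩ := hS
      simp [rowSum_capL, ind_false, key _ _ hB', ClosesRight]
  · simp only [classData, ClassData.mirror]
    rw [← mul_zero (T (-1) : ℤ[T;T⁻¹]), ← zero_mul (stateSum m fun _ => 0), ← stateSum_mul,
      ← stateSum_mul]
    refine stateSum_succ_congr fun S hS => ?_
    cases S with
    | three a b c B' =>
      obtain ⟨ha, hb, hc, -, -, -, hB', -⟩ := hS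
      simp [rowSum_three, ind_false, ne_y' hb, ClosesRight]
    | capL a B' => simp [rowSum_capL, ind_false, ClosesRight]
    | capR a B' => simp [rowSum_capR, ind_false, ClosesRight]
  · simp only [classData, ClassData.mirror]
    rw [← stateSum_mul, ← stateSum_add, ← stateSum_mul]
    refine stateSum_succ_congr fun S hS => ?_
    cases S with
    | three a b c B' =>
      obtain ⟨ha, hb, hc, -, -, -, hB', -⟩ := hS
      have hswap : ∀ z, s(Pt.y m, z) = s(z, Pt.y m) := fun z => Sym2.eq_swap
      have hcomm := Set.insert_comm s(b, c) s(a, Pt.y m) B'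
      simp [rowSum_three, ind_false, ne_y' hb, ClosesLeft, ClosesRight, hcomm, hswap,
        key2 _ _ _ _ ha hb hB', key2 _ _ _ _ hb hc hB']
      rw [T_two_eq, T_neg_two_eq, T_neg_three_eq]
      linear_combination (-T 1 * ind (a = q ∧ insert s(b, c) B' = B)) * T_one_mul_T_neg_one
    | capL a B' => simp [rowSum_capL, ind_false, ClosesLeft, ClosesRight]
    | capR a B' => simp [rowSum_capR, ind_false, ClosesLeft, ClosesRight]
  · intro h
    obtain ⟨S, w, hS, h⟩ := h.exists_step
    have hv := hS.valid
    cases S with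
    | three a b c B' =>
      obtain ⟨ha, hb, hc, -, -, -, hB', -⟩ := hv
      rcases h0 : w 0 <;> rcases h1 : w 1 <;> rcases h2 : w 2 <;>
        simp [step, h0, h1, h2, (ne_y' hb).symm] at h
    | capR a B' =>
      obtain ⟨ha, hB', -⟩ := hv
      rcases h0 : w 0 <;> rcases h1 : w 1 <;> rcases h2 : w 2 <;>
        simp [step, h0, h1, h2] at h
      obtain ⟨rfl, rfl⟩ := (key _ _ hB').1 h.symm
      exact hS
    | capL a B' =>
      rcases h0 : w 0 <;> rcases h1 : w 1 <;> rcases h2 : w 2 <;>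
        simp [step, h0, h1, h2] at h
  · intro h
    obtain ⟨S, w, hS, h⟩ := h.exists_step
    have hv := hS.valid
    cases S with
    | three a b c B' =>
      obtain ⟨ha, hb, hc, -, -, -, hB', -⟩ := hv
      rcases h0 : w 0 <;> rcases h1 : w 1 <;> rcases h2 : w 2 <;>
        simp [step, h0, h1, h2, (ne_y' hb).symm] at h
      exact Or.inr (Or.inr ⟨_, hS, (key2 _ _ _ _ hb hc hB').1 h.symm⟩)
    | capR a B' =>
      obtain ⟨ha, hB', -⟩ := hv
      left
      rcases h0 : w 0 <;> rcases h1 : w 1 <;> rcases h2 : w 2 <;>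
        simp [step, h0, h1, h2] at h <;>
        (obtain ⟨rfl, rfl⟩ := (key _ _ hB').1 h.symm; exact hS)
    | capL a B' =>
      obtain ⟨ha, hB', -⟩ := hv
      right; left
      rcases h0 : w 0 <;> rcases h1 : w 1 <;> rcases h2 : w 2 <;>
        simp [step, h0, h1, h2] at h <;>
        (obtain ⟨rfl, rfl⟩ := (key _ _ hB').1 h.symm; exact hS)
  · rintro ⟨S', hS', h⟩
    obtain ⟨S, w, hS, rfl⟩ := hS'.exists_step
    have hv := hS.valid
    cases S with
    | three a b c B' =>
      obtain ⟨ha, hb, hc, -, -, -, hB', -⟩ := hv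
      rcases h0 : w 0 <;> rcases h1 : w 1 <;> rcases h2 : w 2 <;>
        simp [step, h0, h1, h2, ClosesRight, ne_y' hb] at h
    | capR a B' =>
      rcases h0 : w 0 <;> rcases h1 : w 1 <;> rcases h2 : w 2 <;>
        simp [step, h0, h1, h2, ClosesRight] at h
    | capL a B' =>
      rcases h0 : w 0 <;> rcases h1 : w 1 <;> rcases h2 : w 2 <;>
        simp [step, h0, h1, h2, ClosesRight] at h

end Tangle

/-! ### Three-strand tangles, merging of strands, and cuts -/

namespace Tangle

/-- Caps do not contribute, by the Reidemeister move. A three-strand tangle reaches this one by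
closing its left pair (weight A⁻¹) or its right pair (weight A). -/
theorem stateSum_three_of_class {m : ℕ} {q : Pt} {B : Set (Sym2 Pt)} :
    stateSum (m + 1) (fun S => ind (S = three (.y m) q (.y' m) B)) =
      T (-1) * (classData m q B).left + T 1 * (classData m q B).right := by
  simp only [classData]
  rw [← stateSum_mul, ← stateSum_mul, ← stateSum_add]
  refine stateSum_succ_congr fun S hS => ?_
  cases S with
  | three a b c B' =>
    obtain ⟨ha, hb, hc, -, -, -, hB', -⟩ := hS
    simp [rowSum_three, ind_false, ne_y hb, ne_y' hb, ClosesLeft, ClosesRight]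
  | capL a B' => simp [rowSum_capL, ind_false, ClosesLeft, ClosesRight]
  | capR a B' => simp [rowSum_capR, ind_false, ClosesLeft, ClosesRight]

theorem stateSum_three_left {m : ℕ} {p q r : Pt} {B : Set (Sym2 Pt)} (hq : q.InRows m)
    (hB : ArcsIn m B) :
    stateSum (m + 1) (fun S => ind (S = three q r (.y' m) (insert s(p, .y m) B))) =
      T (-3) * stateSum m fun S => ind (S = three p q r B) := by
  rw [← stateSum_mul]
  refine stateSum_succ_congr fun S hS => ?_
  cases S with
  | three a b c B' =>
    obtain ⟨ha, hb, hc, -, -, -, hB', -⟩ := hS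
    have key : b = q ∧ c = r ∧ insert s(a, .y m) B' = insert s(p, .y m) B ↔
        a = p ∧ b = q ∧ c = r ∧ B' = B := by
      rw [insert_eq_insert_iff_of_fresh hB'.fresh_y hB.fresh_y]
      tauto
    simp [rowSum_three, ind_false, ne_y' hb, (ne_y hq).symm, key]
  | capL a B' => simp [rowSum_capL, ind_false]
  | capR a B' => simp [rowSum_capR, ind_false]

theorem stateSum_three_right {m : ℕ} {p q r : Pt} {B : Set (Sym2 Pt)} (hq : q.InRows m)
    (hB : ArcsIn m B) :
    stateSum (m + 1) (fun S => ind (S = three (.y m) p q (insert s(r, .y' m) B))) =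
      T 3 * stateSum m fun S => ind (S = three p q r B) := by
  rw [← stateSum_mul]
  refine stateSum_succ_congr fun S hS => ?_
  cases S with
  | three a b c B' =>
    obtain ⟨ha, hb, hc, -, -, -, hB', -⟩ := hS
    have key : a = p ∧ b = q ∧ insert s(c, .y' m) B' = insert s(r, .y' m) B ↔
        a = p ∧ b = q ∧ c = r ∧ B' = B := by
      rw [insert_eq_insert_iff_of_fresh hB'.fresh_y' hB.fresh_y']
    simp [rowSum_three, ind_false, ne_y hb, (ne_y' hq).symm, key]
  | capL a B' => simp [rowSum_capL, ind_false]
  | capR a B' => simp [rowSum_capR, ind_false]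

/-- Two arcs end in the new side points, and both can be removed, so a single three-strand tangle
lies above. Its four smoothings sending `p` to the left and `r` to the right, directly or after
closing a floor pair, carry the weights A, A⁻¹, A³, A⁻³. -/
theorem classData_merge {m : ℕ} {p q r : Pt} {B : Set (Sym2 Pt)} (hq : q.InRows m)
    (hr : r.InRows m) (hB : ArcsIn m B) {D : ClassData}
    (hD : D = classData (m + 1) q (insert s(p, .y m) (insert s(r, .y' m) B)))
    {M : ℤ[T;T⁻¹]} (hM : M = stateSum m fun S => ind (S = three p q r B)) :
    D.capL = T 1 * M ∧ D.capR = T (-1) * M ∧ D.left = T 3 * M ∧ D.right = T (-3) * M := by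
  subst hD hM
  have q1 := (ne_y hq).symm
  have q2 := (ne_y' hq).symm
  have key : ∀ (a b c : Pt) (B' : Set (Sym2 Pt)), a.InRows m → c.InRows m → ArcsIn m B' →
      (b = q ∧ insert s(a, .y m) (insert s(c, .y' m) B') =
          insert s(p, .y m) (insert s(r, .y' m) B) ↔
        a = p ∧ b = q ∧ c = r ∧ B' = B) := by
    intro a b c B' ha hc hB'
    have hyy : Pt.y' m ≠ Pt.y m := by simp
    rw [insert_eq_insert_iff_of_fresh (hB'.fresh_y.insert (ne_y hc) hyy)
      (hB.fresh_y.insert (ne_y hr) hyy), insert_eq_insert_iff_of_fresh hB'.fresh_y' hB.fresh_y']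
    tauto
  have hswap : ∀ z, s(Pt.y m, z) = s(z, Pt.y m) := fun z => Sym2.eq_swap
  simp only [classData]
  refine ⟨?_, ?_, ?_, ?_⟩ <;> rw [← stateSum_mul] <;> refine stateSum_succ_congr fun S hS => ?_
  · cases S with
    | three a b c B' =>
      obtain ⟨ha, hb, hc, -, -, -, hB', -⟩ := hS
      simp [rowSum_three, ind_false, q2, key _ _ _ _ ha hc hB']
    | capL a B' => simp [rowSum_capL, ind_false, q1, q2]
    | capR a B' => simp [rowSum_capR, ind_false]
  · cases S with
    | three a b c B' =>
      obtain ⟨ha, hb, hc, -, -, -, hB', -⟩ := hS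
      simp [rowSum_three, ind_false, q1, key _ _ _ _ ha hc hB']
    | capL a B' => simp [rowSum_capL, ind_false]
    | capR a B' => simp [rowSum_capR, ind_false, q1, q2]
  · cases S with
    | three a b c B' =>
      obtain ⟨ha, hb, hc, -, -, -, hB', -⟩ := hS
      simp [rowSum_three, ind_false, q2, ClosesLeft, hswap, key _ _ _ _ ha hc hB']
    | capL a B' => simp [rowSum_capL, ind_false, ClosesLeft]
    | capR a B' => simp [rowSum_capR, ind_false, ClosesLeft]
  · cases S with
    | three a b c B' =>
      obtain ⟨ha, hb, hc, -, -, -, hB', -⟩ := hS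
      simp [rowSum_three, ind_false, q1, ClosesRight,
        Set.insert_comm s(c, Pt.y' m) s(a, Pt.y m) B', key _ _ _ _ ha hc hB']
    | capL a B' => simp [rowSum_capL, ind_false, ClosesRight]
    | capR a B' => simp [rowSum_capR, ind_false, ClosesRight]

/-- Every horizontal line cuts the arcs `B` and the strand which starts in `q` at most once. -/
def CutOnce (m : ℕ) (q : Pt) (B : Set (Sym2 Pt)) : Prop :=
  Covers m {q} B ∧
    ∀ i ≤ m, ∃ p : Pt, ∀ z : Pt, z.InRows i → z ≠ p → ∃ u : Pt, u.InRows i ∧ s(z, u) ∈ B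

theorem CutOnce.succ {m : ℕ} {q q' : Pt} {B B' : Set (Sym2 Pt)} (h : CutOnce m q B)
    (hB : B ⊆ B') (hB' : ArcsIn (m + 1) B') (hc : Covers (m + 1) {q'} B') :
    CutOnce (m + 1) q' B' := by
  refine ⟨hc, fun i hi => ?_⟩
  rcases Nat.le_succ_iff.1 hi with hi | rfl
  · obtain ⟨p, hp⟩ := h.2 i hi
    exact ⟨p, fun z hz hzp => (hp z hz hzp).imp fun u hu => ⟨hu.1, hB hu.2⟩⟩
  · refine ⟨q', fun z hz hzq => ?_⟩
    rcases hc z hz with h | ⟨u, hu⟩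
    · exact absurd h hzq
    · exact ⟨u, (hB' z u hu).2.1, hu⟩

theorem CutOnce.right {m : ℕ} {q : Pt} {B : Set (Sym2 Pt)} (h : CutOnce m q B) (hq : q.InRows m)
    (hB : ArcsIn m B) : CutOnce (m + 1) (.y m) (insert s(q, .y' m) B) := by
  refine h.succ (Set.subset_insert _ _)
    (hB.succ.insert hq.succ (inRows_y' m) (ne_y' hq)) (h.1.step (Set.subset_insert _ _) ?_ ?_ ?_)
  · rintro z rfl
    exact Or.inr ⟨_, Or.inl rfl⟩
  · exact Or.inl rfl
  · exact Or.inr ⟨_, Or.inl Sym2.eq_swap⟩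

theorem CutOnce.left {m : ℕ} {q : Pt} {B : Set (Sym2 Pt)} (h : CutOnce m q B) (hq : q.InRows m)
    (hB : ArcsIn m B) : CutOnce (m + 1) (.y' m) (insert s(q, .y m) B) := by
  refine h.succ (Set.subset_insert _ _)
    (hB.succ.insert hq.succ (inRows_y m) (ne_y hq)) (h.1.step (Set.subset_insert _ _) ?_ ?_ ?_)
  · rintro z rfl
    exact Or.inr ⟨_, Or.inl rfl⟩
  · exact Or.inr ⟨_, Or.inl Sym2.eq_swap⟩
  · exact Or.inl rfl

end Tangle

/-! ### Closed forms for the recursion -/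

/-- A power of the variable times a product of the analogues of two and three at its fourth
power. -/
def IsAnalogueProduct (f : ℤ[T;T⁻¹]) : Prop :=
  ∃ (e : ℤ) (a b : ℕ), f = T e * qAnalogue (T 4) 2 ^ a * qAnalogue (T 4) 3 ^ b

theorem isAnalogueProduct_T (e : ℤ) : IsAnalogueProduct (T e) := ⟨e, 0, 0, by simp⟩

theorem isAnalogueProduct_one : IsAnalogueProduct 1 := ⟨0, 0, 0, by simp⟩

theorem IsAnalogueProduct.mul {f g : ℤ[T;T⁻¹]} (hf : IsAnalogueProduct f)
    (hg : IsAnalogueProduct g) : IsAnalogueProduct (f * g) := by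
  obtain ⟨e, a, b, rfl⟩ := hf
  obtain ⟨e', a', b', rfl⟩ := hg
  exact ⟨e + e', a + a', b + b', by rw [T_add, pow_add, pow_add]; ring⟩

theorem IsAnalogueProduct.pow {f : ℤ[T;T⁻¹]} (hf : IsAnalogueProduct f) (n : ℕ) :
    IsAnalogueProduct (f ^ n) := by
  induction n with
  | zero => simpa using isAnalogueProduct_one
  | succ n ih => rw [pow_succ]; exact ih.mul hf

/-- Minus the factor of a closed component. -/
noncomputable def chi : ℤ[T;T⁻¹] := T 2 + T (-2)

theorem isAnalogueProduct_chi : IsAnalogueProduct chi := by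
  refine ⟨-2, 1, 0, ?_⟩
  simp only [chi, qAnalogue, Finset.sum_range_succ, Finset.sum_range_zero, pow_zero, pow_one,
    mul_one, zero_add, mul_add, ← T_add]
  norm_num
  rw [add_comm]

theorem isAnalogueProduct_chi_sq_sub_one : IsAnalogueProduct (chi ^ 2 - 1) := by
  refine ⟨-4, 0, 1, ?_⟩
  simp only [chi, qAnalogue, Finset.sum_range_succ, Finset.sum_range_zero, pow_zero, pow_one,
    mul_one, zero_add, mul_add, add_mul, sq, ← T_add]
  norm_num
  ring

/-- A geometric sum in `chi ^ 2`. -/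
noncomputable def geomChi (k : ℕ) : ℤ[T;T⁻¹] := ∑ i ∈ Finset.range k, (chi ^ 2) ^ i

theorem geomChi_succ (k : ℕ) : geomChi (k + 1) = geomChi k + chi ^ (2 * k) := by
  rw [geomChi, Finset.sum_range_succ, ← pow_mul]; rfl

namespace Tangle.ClassData

/-- The class in which a horizontal line with three intersections is followed by one with a single
intersection. -/
def Start (a b : ℤ[T;T⁻¹]) (D : ClassData) : Prop :=
  ∃ M, IsAnalogueProduct M ∧ D.capL = a * M ∧ D.capR = b * M ∧ D.left = a ^ 3 * M ∧
    D.right = b ^ 3 * M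

/-- A class of tangles with a horizontal line with three intersections. -/
def Thick (D : ClassData) : Prop :=
  ∃ M j, IsAnalogueProduct M ∧ D.capL = M * chi ^ (j + 1) ∧ D.capR = M * chi ^ j ∧
    D.left = M * (chi ^ j * (chi ^ 2 - 1)) ∧ D.right = 0

/-- A class of tangles in which all horizontal lines have a single intersection. -/
def Thin (D : ClassData) : Prop :=
  ∃ M k, IsAnalogueProduct M ∧
    ((D.capL = M * (chi * geomChi k) ∧ D.capR = M * geomChi k ∧ D.left = M * chi ^ (2 * k) ∧
        D.right = 0 ∧ (D.hasCapL ∨ D.hasCapR → 1 ≤ k) ∧ ¬ D.hasRight) ∨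
      (D.capL = M * (chi * geomChi k) ∧ D.capR = M * geomChi (k + 1) ∧ D.left = 0 ∧
        D.right = M * chi ^ (2 * k + 1) ∧ (D.hasCapL → 1 ≤ k)))

/-- Since ab = 1, the caps satisfy b + a³ = aχ, and the three-strand sum is b³ + χa³ = a(a⁴ + 1 +
b⁴) = a(χ² - 1). This is where [3] at A⁴ enters. -/
theorem Start.step {a b τ : ℤ[T;T⁻¹]} {D D' : ClassData} (h : D.Start a b) (hab : a * b = 1)
    (ha : IsAnalogueProduct a) (hx : chi = a ^ 2 + b ^ 2) (hτ : IsAnalogueProduct τ)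
    (hs : D.Step τ D') : D'.mirror.Thick := by
  obtain ⟨M, hM, h1, h2, h3, h4⟩ := h
  refine ⟨τ * a * M, 0, (hτ.mul ha).mul hM, ?_, ?_, ?_, ?_⟩
  · simp only [mirror, hs.capR, h2, h3, hx]
    linear_combination (-τ * b * M) * hab
  · simp only [mirror, hs.capL, h1]
    ring
  · simp only [mirror, hs.right, h3, h4]
    rw [← chi, hx]
    linear_combination (τ * M) * (-a * (a * b + 1) - b ^ 3) * hab
  · simp only [mirror, hs.left]

/-- A turn to the opposite side adds capR and left, χ^j + χ^j(χ² - 1) = χ^(j+2), raising the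
exponent by one. A turn to the same side as before only multiplies by the unit. -/
theorem Thick.step {τ : ℤ[T;T⁻¹]} {D D' : ClassData} (h : D.Thick ∨ D.mirror.Thick)
    (hτ : IsAnalogueProduct τ) (hs : D.Step τ D') : D'.mirror.Thick := by
  rcases h with ⟨M, j, hM, h1, h2, h3, h4⟩ | ⟨M, j, hM, h1, h2, h3, h4⟩ <;>
    try simp only [mirror] at h1 h2 h3 h4
  · refine ⟨τ * M, j + 1, hτ.mul hM, ?_, ?_, ?_, ?_⟩ <;> simp only [mirror]
    · rw [hs.capR, h2, h3]; ring
    · rw [hs.capL, h1]; ring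
    · rw [hs.right, h3, h4, ← chi]; ring
    · rw [hs.left]
  · refine ⟨τ * M, j, hτ.mul hM, ?_, ?_, ?_, ?_⟩ <;> simp only [mirror]
    · rw [hs.capR, h1, h4]; ring
    · rw [hs.capL, h2]; ring
    · rw [hs.right, h3, h4]; ring
    · rw [hs.left]

/-- Again only changes of side matter. They append the next term χ^(2k) to the geometric sum in one
cap, or χ·χ^(2k) to χ times that sum in the other, alternately. Since loops contribute signs, a
tangle may occur without its sum being visibly nonzero, so the inequality 1 ≤ k is carried along
through occurrence; excluding `hasRight` in the first form handles a cap newly made from a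
three-strand tangle. -/
theorem Thin.step {τ : ℤ[T;T⁻¹]} {D D' : ClassData} (h : D.Thin ∨ D.mirror.Thin)
    (hτ : IsAnalogueProduct τ) (hs : D.Step τ D') : D'.Thin ∨ D'.mirror.Thin := by
  rcases h with ⟨M, k, hM, ⟨h1, h2, h3, h4, h5, h6⟩ | ⟨h1, h2, h3, h4, h5⟩⟩ |
    ⟨M, k, hM, ⟨h1, h2, h3, h4, h5, h6⟩ | ⟨h1, h2, h3, h4, h5⟩⟩ <;>
    try simp only [mirror] at h1 h2 h3 h4 h5
  · refine Or.inl ⟨τ * M, k, hτ.mul hM, Or.inr ⟨?_, ?_, hs.left, ?_, ?_⟩⟩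
    · rw [hs.capL, h1]; ring
    · rw [hs.capR, h2, h3, geomChi_succ]; ring
    · rw [hs.right, h3, h4, ← chi]; ring
    · exact fun h => h5 (Or.inl (hs.hasCapL h))
  · refine Or.inl ⟨τ * M, k, hτ.mul hM, Or.inr ⟨?_, ?_, hs.left, ?_, ?_⟩⟩
    · rw [hs.capL, h1]; ring
    · rw [hs.capR, h2, h3]; ring
    · rw [hs.right, h3, h4]; ring
    · exact fun h => h5 (hs.hasCapL h)
  · refine Or.inr ⟨τ * M, k, hτ.mul hM, Or.inl ⟨?_, ?_, ?_, hs.left, ?_, hs.hasLeft⟩⟩ <;>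
      simp only [mirror]
    · rw [hs.capR, h1, h4]; ring
    · rw [hs.capL, h2]; ring
    · rw [hs.right, h3, h4]; ring
    · rintro (h | h)
      · rcases hs.hasCapR h with h | h | h
        · exact h5 (Or.inr h)
        · exact h5 (Or.inl h)
        · exact absurd h h6
      · exact h5 (Or.inr (hs.hasCapL h))
  · refine Or.inr ⟨τ * M, k + 1, hτ.mul hM, Or.inl ⟨?_, ?_, ?_, hs.left, ?_, hs.hasLeft⟩⟩ <;>
      simp only [mirror]
    · rw [hs.capR, h1, h4, geomChi_succ]; ring
    · rw [hs.capL, h2]; ring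
    · rw [hs.right, h3, h4, ← chi]; ring
    · exact fun _ => Nat.le_add_left 1 k

end Tangle.ClassData

/-! ### Positive palindromic polynomials -/

/-- A palindromic polynomial of degree `N` with positive coefficients, the first one being one. -/
structure PosPalindrome (N : ℕ) (p : Polynomial ℤ) : Prop where
  natDegree_le : p.natDegree ≤ N
  coeff_zero : p.coeff 0 = 1
  reflect_eq : p.reflect N = p
  coeff_pos : ∀ i ≤ N, 0 < p.coeff i

namespace PosPalindrome

open Polynomial

theorem coeff_nonneg {N : ℕ} {p : ℤ[X]} (h : PosPalindrome N p) (i : ℕ) : 0 ≤ p.coeff i := by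
  rcases le_or_gt i N with hi | hi
  · exact (h.coeff_pos i hi).le
  · exact (coeff_eq_zero_of_natDegree_lt (h.natDegree_le.trans_lt hi)).ge

theorem coeff_sub {N : ℕ} {p : ℤ[X]} (h : PosPalindrome N p) {i : ℕ} (hi : i ≤ N) :
    p.coeff i = p.coeff (N - i) := by
  conv_lhs => rw [← h.reflect_eq]
  rw [coeff_reflect, revAt_le hi]

theorem mul {N N' : ℕ} {p q : ℤ[X]} (hp : PosPalindrome N p) (hq : PosPalindrome N' q) :
    PosPalindrome (N + N') (p * q) where
  natDegree_le := natDegree_mul_le.trans (add_le_add hp.natDegree_le hq.natDegree_le)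
  coeff_zero := by rw [mul_coeff_zero, hp.coeff_zero, hq.coeff_zero, one_mul]
  reflect_eq := by
    rw [reflect_mul p q hp.natDegree_le hq.natDegree_le, hp.reflect_eq, hq.reflect_eq]
  coeff_pos := by
    intro n hn
    rw [coeff_mul]
    -- All products are nonnegative; the antidiagonal term taking as much degree as possible from
    -- the first factor has both indices in range.
    refine Finset.sum_pos' (fun x _ => mul_nonneg (hp.coeff_nonneg _) (hq.coeff_nonneg _))
      ⟨(min n N, n - min n N), ?_, mul_pos (hp.coeff_pos _ ?_) (hq.coeff_pos _ ?_)⟩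
    · rw [Finset.HasAntidiagonal.mem_antidiagonal]; omega
    · exact min_le_right _ _
    · omega

theorem one : PosPalindrome 0 1 where
  natDegree_le := by simp
  coeff_zero := by simp
  reflect_eq := by simp
  coeff_pos := by simp

theorem pow {N : ℕ} {p : ℤ[X]} (hp : PosPalindrome N p) (n : ℕ) :
    PosPalindrome (n * N) (p ^ n) := by
  induction n with
  | zero => simpa using one
  | succ n ih => rw [pow_succ, add_mul, one_mul]; exact ih.mul hp

theorem two : PosPalindrome 1 (1 + X : ℤ[X]) where
  natDegree_le := by compute_degree
  coeff_zero := by simp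
  reflect_eq := by
    rw [reflect_add, ← C_1, reflect_C, ← pow_one (X : ℤ[X]), reflect_monomial]
    simp [revAt_le, add_comm]
  coeff_pos := by
    intro i hi
    interval_cases i <;> simp [coeff_one, coeff_X]

/-- `X` is its own reflection in degree 2, so `X * q` has the same centre of symmetry as `p`. It
changes neither the constant term nor the positivity. -/
theorem add_X_mul {N : ℕ} {p q : ℤ[X]} (hp : PosPalindrome (2 + N) p) (hq : PosPalindrome N q) :
    PosPalindrome (2 + N) (p + X * q) where
  natDegree_le := (natDegree_add_le _ _).trans (max_le hp.natDegree_le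
    (natDegree_mul_le.trans (add_le_add (natDegree_X_le.trans one_le_two) hq.natDegree_le)))
  coeff_zero := by simp [hp.coeff_zero]
  reflect_eq := by
    have hX : reflect 2 (X : ℤ[X]) = X := by
      conv_lhs => rw [← pow_one (X : ℤ[X]), reflect_monomial]
      simp [revAt_le]
    rw [reflect_add, reflect_mul X q (natDegree_X_le.trans one_le_two) hq.natDegree_le, hX,
      hq.reflect_eq, hp.reflect_eq]
  coeff_pos := by
    intro i hi
    rw [coeff_add]
    refine add_pos_of_pos_of_nonneg (hp.coeff_pos i hi) ?_
    cases i with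
    | zero => simp
    | succ i => rw [coeff_X_mul]; exact hq.coeff_nonneg i

theorem three : PosPalindrome 2 (1 + X + X ^ 2 : ℤ[X]) := by
  have h : (1 + X + X ^ 2 : ℤ[X]).natDegree ≤ 2 := by compute_degree
  refine ⟨h, by simp, ?_, ?_⟩
  · ext i
    rw [coeff_reflect]
    rcases le_or_gt i 2 with hi | hi
    · rw [revAt_le hi]
      interval_cases i <;> simp [coeff_one, coeff_X, coeff_X_pow]
    · rw [revAt_eq_self_of_lt hi]
  · intro i hi
    interval_cases i <;> simp [coeff_one, coeff_X, coeff_X_pow]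

end PosPalindrome

/-- A Laurent polynomial whose exponents form an arithmetic progression with difference four and
whose coefficients are positive and palindromic, the first one being one. -/
def IsPosPalindrome (f : ℤ[T;T⁻¹]) : Prop :=
  ∃ (d : ℤ) (N : ℕ) (p : Polynomial ℤ), PosPalindrome N p ∧
    f = T d * Polynomial.aeval (T 4 : ℤ[T;T⁻¹]) p

theorem IsPosPalindrome.mul {f g : ℤ[T;T⁻¹]} (hf : IsPosPalindrome f) (hg : IsPosPalindrome g) :
    IsPosPalindrome (f * g) := by
  obtain ⟨d, N, p, hp, rfl⟩ := hf
  obtain ⟨d', N', q, hq, rfl⟩ := hg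
  exact ⟨d + d', N + N', p * q, hp.mul hq, by rw [T_add, map_mul]; ring⟩

theorem IsAnalogueProduct.isPosPalindrome {f : ℤ[T;T⁻¹]} (hf : IsAnalogueProduct f) :
    IsPosPalindrome f := by
  obtain ⟨e, a, b, rfl⟩ := hf
  refine ⟨e, _, _, (PosPalindrome.two.pow a).mul (PosPalindrome.three.pow b), ?_⟩
  simp [qAnalogue, Finset.sum_range_succ, mul_assoc]

theorem geomChi_isPosPalindrome {k : ℕ} (hk : 1 ≤ k) : IsPosPalindrome (geomChi k) := by
  obtain ⟨k, rfl⟩ := Nat.exists_eq_add_of_le' hk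
  suffices ∃ p, PosPalindrome (2 * k) p ∧
      geomChi (k + 1) = T (-4 * k) * Polynomial.aeval (T 4 : ℤ[T;T⁻¹]) p by
    obtain ⟨p, hp, h⟩ := this
    exact ⟨_, _, p, hp, h⟩
  induction k with
  | zero => exact ⟨1, PosPalindrome.one, by simp [geomChi]⟩
  | succ k ih =>
    obtain ⟨p, hp, h⟩ := ih (Nat.le_add_left 1 k)
    -- The new term is χ^(2(k+1)) = A^(-4(k+1)) (1 + A⁴)^(2(k+1)); lowering the common factor from
    -- A^(-4k) to A^(-4(k+1)) multiplies the old polynomial by `X`.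
    refine ⟨(1 + Polynomial.X) ^ (2 * (k + 1)) + Polynomial.X * p, ?_, ?_⟩
    · have h2 := PosPalindrome.two.pow (2 * (k + 1))
      have e1 : 2 * (k + 1) * 1 = 2 + 2 * k := by ring
      have e2 : 2 * (k + 1) = 2 + 2 * k := by ring
      rw [e1] at h2
      have := h2.add_X_mul hp
      rwa [e2] at this ⊢
    · have hchi : chi = T (-2) * (1 + T 4) := by
        rw [chi, mul_add, ← T_add]; norm_num; rw [add_comm]
      have e1 : (T (-4 * (k : ℤ)) : ℤ[T;T⁻¹]) = T (-4 * ((k + 1 : ℕ) : ℤ)) * T 4 := by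
        rw [← T_add]; congr 1; push_cast; ring
      have e2 : (T (-2) : ℤ[T;T⁻¹]) ^ (2 * (k + 1)) = T (-4 * ((k + 1 : ℕ) : ℤ)) := by
        rw [T_pow]; congr 1; push_cast; ring
      rw [geomChi_succ, h, hchi, mul_pow, e2, e1]
      simp only [map_add, map_mul, map_pow, map_one, Polynomial.aeval_X]
      ring

theorem IsPosPalindrome.exists_coeffs {f : ℤ[T;T⁻¹]} (hf : IsPosPalindrome f) :
    ∃ (d : ℤ) (N : ℕ) (c : ℕ → ℤ),
      f = ∑ i ∈ Finset.range (N + 1), LaurentPolynomial.C (c i) * T (d + 4 * (i : ℤ)) ∧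
      c 0 = 1 ∧ c N = 1 ∧ (∀ i ≤ N, c i = c (N - i)) ∧ ∀ i ≤ N, 0 < c i := by
  obtain ⟨d, N, p, hp, rfl⟩ := hf
  refine ⟨d, N, p.coeff, ?_, hp.coeff_zero, ?_, fun i hi => hp.coeff_sub hi, hp.coeff_pos⟩
  · rw [Polynomial.aeval_eq_sum_range' (Nat.lt_succ_of_le hp.natDegree_le), Finset.mul_sum]
    refine Finset.sum_congr rfl fun i _ => ?_
    rw [T_pow, Algebra.smul_def, T_add, mul_comm (4 : ℤ)]
    change T d * (C (p.coeff i) * _) = _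
    ring
  · rw [hp.coeff_sub le_rfl, Nat.sub_self, hp.coeff_zero]

/-! ### Induction over the rows -/

namespace Tangle

/-- The state sums over a class have one of the possible forms. -/
def GoodClass (m : ℕ) (q : Pt) (B : Set (Sym2 Pt)) : Prop :=
  q.InRows m ∧ ArcsIn m B ∧
    ((classData m q B).Start (T 1) (T (-1)) ∨
      ((classData m q B).Thick ∨ (classData m q B).mirror.Thick) ∨
      (((classData m q B).Thin ∨ (classData m q B).mirror.Thin) ∧ CutOnce m q B))

theorem chi_eq : chi = T 1 ^ 2 + T (-1) ^ 2 := by rw [chi, T_two_eq, T_neg_two_eq]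

theorem GoodClass.right {m : ℕ} {q : Pt} {B : Set (Sym2 Pt)} (h : GoodClass m q B) :
    GoodClass (m + 1) (.y m) (insert s(q, .y' m) B) := by
  obtain ⟨hq, hB, h⟩ := h
  have hs := classData_step_right hq hB
  have hT := isAnalogueProduct_T 1
  refine ⟨inRows_y m, hB.succ.insert hq.succ (inRows_y' m) (ne_y' hq), Or.inr ?_⟩
  rcases h with h | h | ⟨h, hc⟩
  · exact Or.inl (Or.inr (h.step T_one_mul_T_neg_one hT chi_eq hT hs))
  · exact Or.inl (Or.inr (ClassData.Thick.step h hT hs))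
  · exact Or.inr ⟨ClassData.Thin.step h hT hs, hc.right hq hB⟩

theorem GoodClass.left {m : ℕ} {q : Pt} {B : Set (Sym2 Pt)} (h : GoodClass m q B) :
    GoodClass (m + 1) (.y' m) (insert s(q, .y m) B) := by
  obtain ⟨hq, hB, h⟩ := h
  have hs := classData_step_left hq hB
  have hT := isAnalogueProduct_T (-1)
  refine ⟨inRows_y' m, hB.succ.insert hq.succ (inRows_y m) (ne_y hq), Or.inr ?_⟩
  rcases h with h | h | ⟨h, hc⟩
  · have h' : (classData m q B).mirror.Start (T (-1)) (T 1) := by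
      obtain ⟨M, hM, h1, h2, h3, h4⟩ := h
      exact ⟨M, hM, h2, h1, h4, h3⟩
    exact Or.inl (Or.inl (h'.step ((mul_comm _ _).trans T_one_mul_T_neg_one) hT
      (chi_eq.trans (add_comm _ _)) hT hs))
  · exact Or.inl (Or.inl (ClassData.Thick.step h.symm hT hs))
  · exact Or.inr ⟨(ClassData.Thin.step h.symm hT hs).symm, hc.left hq hB⟩

theorem goodClass_merge {m : ℕ} {p q r : Pt} {B : Set (Sym2 Pt)} (hp : p.InRows m)
    (hq : q.InRows m) (hr : r.InRows m) (hB : ArcsIn m B)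
    (h : IsAnalogueProduct (stateSum m fun S => ind (S = three p q r B))) :
    GoodClass (m + 1) q (insert s(p, .y m) (insert s(r, .y' m) B)) := by
  obtain ⟨h1, h2, h3, h4⟩ := classData_merge (p := p) hq hr hB rfl rfl
  refine ⟨hq.succ, (hB.succ.insert hr.succ (inRows_y' m) (ne_y' hr)).insert hp.succ (inRows_y m)
    (ne_y hp), Or.inl ⟨_, h, h1, h2, ?_, ?_⟩⟩
  · rw [h3, T_three_eq]
  · rw [h4, T_neg_three_eq]

/-- At the start the two contributions add up to χM. In every other form one of left and right
vanishes and the other is a product, so geometric sums never enter three-strand tangles. -/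
theorem GoodClass.three {m : ℕ} {q : Pt} {B : Set (Sym2 Pt)} (h : GoodClass m q B) :
    IsAnalogueProduct (stateSum (m + 1) fun S => ind (S = three (.y m) q (.y' m) B)) := by
  rw [stateSum_three_of_class]
  have hT := isAnalogueProduct_T 1
  have hT' := isAnalogueProduct_T (-1)
  have hx := isAnalogueProduct_chi
  have hx' := isAnalogueProduct_chi_sq_sub_one
  obtain ⟨-, -, ⟨M, hM, -, -, h3, h4⟩ | (⟨M, j, hM, -, -, h3, h4⟩ | ⟨M, j, hM, -, -, h3, h4⟩) |
    ⟨(⟨M, k, hM, ⟨-, -, h3, h4, -⟩ | ⟨-, -, h3, h4, -⟩⟩ |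
      ⟨M, k, hM, ⟨-, -, h3, h4, -⟩ | ⟨-, -, h3, h4, -⟩⟩), -⟩⟩ := h <;>
    try simp only [ClassData.mirror] at h3 h4
  · have : T (-1) * (classData m q B).left + T 1 * (classData m q B).right = chi * M := by
      rw [h3, h4, chi_eq]
      linear_combination (T 1 ^ 2 + T (-1) ^ 2) * M * T_one_mul_T_neg_one
    rw [this]
    exact hx.mul hM
  all_goals rw [h3, h4, mul_zero]; first | rw [add_zero] | rw [zero_add]
  · exact hT'.mul (hM.mul ((hx.pow j).mul hx'))
  · exact hT.mul (hM.mul ((hx.pow j).mul hx'))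
  · exact hT'.mul (hM.mul (hx.pow _))
  · exact hT.mul (hM.mul (hx.pow _))
  · exact hT.mul (hM.mul (hx.pow _))
  · exact hT'.mul (hM.mul (hx.pow _))

/-- The possible values of the state sum over the smoothings which give a fixed tangle. -/
def HasForm (f : ℤ[T;T⁻¹]) (P : Prop) : Prop :=
  (∃ M k, IsAnalogueProduct M ∧ 1 ≤ k ∧ f = M * geomChi k) ∧ (IsAnalogueProduct f ∨ P)

theorem geomChi_one : geomChi 1 = 1 := by simp [geomChi]

theorem IsAnalogueProduct.hasForm {f : ℤ[T;T⁻¹]} (h : IsAnalogueProduct f) (P : Prop) :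
    HasForm f P :=
  ⟨⟨f, 1, h, le_rfl, by rw [geomChi_one, mul_one]⟩, Or.inl h⟩

/-- Occurrence of the cap excludes k = 0, where the geometric sum is empty. An extra χ is absorbed
into the product. -/
theorem hasForm_of_thin {D : ClassData} {P : Prop} (h : D.Thin ∨ D.mirror.Thin) (hP : P)
    (hD : D.hasCapL) : HasForm D.capL P := by
  have hx := isAnalogueProduct_chi
  refine ⟨?_, Or.inr hP⟩
  rcases h with ⟨M, k, hM, ⟨h1, -, -, -, h5, -⟩ | ⟨h1, -, -, -, h5⟩⟩ |
    ⟨M, k, hM, ⟨-, h1, -, -, h5, -⟩ | ⟨-, h1, -⟩⟩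
  · exact ⟨M * chi, k, hM.mul hx, h5 (Or.inl hD), by rw [h1, mul_assoc]⟩
  · exact ⟨M * chi, k, hM.mul hx, h5 hD, by rw [h1, mul_assoc]⟩
  · exact ⟨M, k, hM, h5 (Or.inr hD), h1⟩
  · exact ⟨M, k + 1, hM, Nat.le_add_left 1 k, h1⟩

theorem GoodClass.hasForm_capL {m : ℕ} {q : Pt} {B : Set (Sym2 Pt)} (h : GoodClass m q B)
    (hocc : Occurs m (capL q B)) :
    HasForm (stateSum m fun S => ind (S = capL q B)) (CutOnce m q B) := by
  have hx := isAnalogueProduct_chi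
  change HasForm (classData m q B).capL _
  obtain ⟨-, -, ⟨M, hM, h1, -⟩ | (⟨M, j, hM, h1, -⟩ | ⟨M, j, hM, -, h1, -⟩) | ⟨h, hc⟩⟩ := h
  · exact IsAnalogueProduct.hasForm (h1 ▸ (isAnalogueProduct_T 1).mul hM) _
  · exact IsAnalogueProduct.hasForm (h1 ▸ hM.mul (hx.pow _)) _
  · have h1 : (classData m q B).capL = M * chi ^ j := h1
    exact IsAnalogueProduct.hasForm (h1 ▸ hM.mul (hx.pow _)) _
  · exact hasForm_of_thin h hc hocc

theorem GoodClass.hasForm_capR {m : ℕ} {q : Pt} {B : Set (Sym2 Pt)} (h : GoodClass m q B)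
    (hocc : Occurs m (capR q B)) :
    HasForm (stateSum m fun S => ind (S = capR q B)) (CutOnce m q B) := by
  have hx := isAnalogueProduct_chi
  change HasForm (classData m q B).mirror.capL _
  obtain ⟨-, -, ⟨M, hM, -, h1, -⟩ | (⟨M, j, hM, -, h1, -⟩ | ⟨M, j, hM, h1, -⟩) | ⟨h, hc⟩⟩ := h
  · have h1 : (classData m q B).mirror.capL = _ := h1
    exact IsAnalogueProduct.hasForm (h1 ▸ (isAnalogueProduct_T (-1)).mul hM) _
  · have h1 : (classData m q B).mirror.capL = _ := h1
    exact IsAnalogueProduct.hasForm (h1 ▸ hM.mul (hx.pow _)) _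
  · exact IsAnalogueProduct.hasForm (h1 ▸ hM.mul (hx.pow _)) _
  · exact hasForm_of_thin h.symm hc hocc

/-- The state sum over the smoothings which give the tangle, and those over its classes, have one of
the possible forms. -/
def Good (m : ℕ) : Tangle → Prop
  | three p q r B => IsAnalogueProduct (stateSum m fun S => ind (S = three p q r B)) ∧
      GoodClass m r (insert s(p, q) B) ∧ GoodClass m p (insert s(q, r) B)
  | capL q B => GoodClass m q B
  | capR q B => GoodClass m q B

/-- Each of the eight smoothings leads to classes of three types: the merged class of
`goodClass_merge`, or a left or right continuation of a class obtained by closing a floor pair. This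
is why `Good` records both closures of a three-strand tangle. -/
theorem Good.step {m : ℕ} {S : Tangle} (hS : S.Valid m) (h : S.Good m) (w : Fin 3 → Bool) :
    (S.step m w).Good (m + 1) := by
  cases S with
  | three p q r B =>
    obtain ⟨hp, hq, hr, -, -, -, hB, -⟩ := hS
    obtain ⟨h1, h2, h3⟩ := h
    have hmerge := goodClass_merge hp hq hr hB h1
    have e1 : insert s(p, q) (insert s(r, .y' m) B) = insert s(r, .y' m) (insert s(p, q) B) :=
      Set.insert_comm _ _ _
    have e2 : insert s(q, r) (insert s(p, .y m) B) = insert s(p, .y m) (insert s(q, r) B) :=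
      Set.insert_comm _ _ _
    have e3 : insert s(r, Pt.y' m) (insert s(p, .y m) B) =
      insert s(p, .y m) (insert s(r, .y' m) B) := Set.insert_comm _ _ _
    have e4 : ∀ z, s(Pt.y m, z) = s(z, Pt.y m) := fun z => Sym2.eq_swap
    rcases h0 : w 0 <;> rcases h1' : w 1 <;> rcases h2' : w 2 <;>
      simp only [Tangle.step, h0, h1', h2', Good, e1, e2, e3, e4]
    · exact ⟨by rw [stateSum_three_left hq hB]; exact (isAnalogueProduct_T _).mul h1, h3.left,
        hmerge⟩
    · exact hmerge
    · exact h3.left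
    · exact hmerge
    · exact ⟨h2.three, h2.left, h2.right⟩
    · exact h2.right
    · exact ⟨h3.three, h3.left, h3.right⟩
    · exact ⟨by rw [stateSum_three_right hq hB]; exact (isAnalogueProduct_T _).mul h1, hmerge,
        h2.right⟩
  | capL q B =>
    have h : GoodClass m q B := h
    have e : s(Pt.y m, q) = s(q, Pt.y m) := Sym2.eq_swap
    rcases h0 : w 0 <;> rcases h1 : w 1 <;> rcases h2 : w 2 <;>
      simp only [Tangle.step, h0, h1, h2, Good, e] <;>
      first
        | exact h.right
        | exact h.left
        | exact ⟨h.three, h.left, h.right⟩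
  | capR q B =>
    have h : GoodClass m q B := h
    have e : s(Pt.y m, q) = s(q, Pt.y m) := Sym2.eq_swap
    rcases h0 : w 0 <;> rcases h1 : w 1 <;> rcases h2 : w 2 <;>
      simp only [Tangle.step, h0, h1, h2, Good, e] <;>
      first
        | exact h.right
        | exact h.left
        | exact ⟨h.three, h.left, h.right⟩

theorem cutOnce_zero {q a b : Pt} (h : ∀ z : Pt, z.InRows 0 → z = q ∨ z = a ∨ z = b)
    (ha : a.InRows 0) (hb : b.InRows 0) : CutOnce 0 q (insert s(a, b) ∅) := by
  refine ⟨fun z hz => ?_, fun i hi => ⟨q, fun z hz hzq => ?_⟩⟩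
  · rcases h z hz with rfl | rfl | rfl
    · exact Or.inl rfl
    · exact Or.inr ⟨b, Or.inl rfl⟩
    · exact Or.inr ⟨a, Or.inl Sym2.eq_swap⟩
  · obtain rfl : i = 0 := by omega
    rcases h z hz with rfl | rfl | rfl
    · exact absurd rfl hzq
    · exact ⟨b, hb, Or.inl rfl⟩
    · exact ⟨a, ha, Or.inl Sym2.eq_swap⟩

/-- Both closures of the empty tangle are thin with k = 0: one three-strand sum is 1 and all others
vanish. The lower bound on k holds vacuously because no cap occurs yet. -/
theorem good_init : init.Good 0 := by
  have hocc : ∀ {S : Tangle}, Occurs 0 S → S = init := by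
    rintro S ⟨s, rfl⟩
    rfl
  have hempty : ArcsIn 0 ∅ := fun a b h => h.elim
  have hcases : ∀ z : Pt, z.InRows 0 → z = .x 0 ∨ z = .x 1 ∨ z = .x 2 := by
    intro z hz
    match z, hz with
    | .x j, _ => fin_cases j <;> simp
    | .y k, h => exact absurd h (Nat.not_lt_zero k)
    | .y' k, h => exact absurd h (Nat.not_lt_zero k)
  have hg : geomChi 0 = 0 := by simp [geomChi]
  refine ⟨?_, ⟨trivial, hempty.insert trivial trivial (by simp), Or.inr (Or.inr ⟨Or.inl ⟨1, 0,
    isAnalogueProduct_one, Or.inl ⟨?_, ?_, ?_, ?_, ?_, ?_⟩⟩, cutOnce_zero ?_ trivial trivial⟩)⟩,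
    ⟨trivial, hempty.insert trivial trivial (by simp), Or.inr (Or.inr ⟨Or.inr ⟨1, 0,
    isAnalogueProduct_one, Or.inl ⟨?_, ?_, ?_, ?_, ?_, ?_⟩⟩, cutOnce_zero ?_ trivial trivial⟩)⟩⟩
  · rw [stateSum_zero]
    simpa [init, ind_true] using isAnalogueProduct_one
  · simp [classData, stateSum_zero, init, ind_false, hg]
  · simp [classData, stateSum_zero, init, ind_false, hg]
  · simp [classData, stateSum_zero, init, ind_true, ClosesLeft]
  · simp [classData, stateSum_zero, init, ind_false, ClosesRight]
  · rintro (h | h) <;> exact absurd (hocc h) (by simp [init])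
  · rintro ⟨S, hS, h⟩
    obtain rfl := hocc hS
    simp [init, ClosesRight] at h
  · intro z hz
    rcases hcases z hz with h | h | h <;> simp [h]
  · simp [classData, stateSum_zero, init, ind_false, hg, ClassData.mirror]
  · simp [classData, stateSum_zero, init, ind_false, hg, ClassData.mirror]
  · simp [classData, stateSum_zero, init, ind_true, ClosesRight, ClassData.mirror]
  · simp [classData, stateSum_zero, init, ind_false, ClosesLeft, ClassData.mirror]
  · rintro (h | h) <;> exact absurd (hocc h) (by simp [init])
  · rintro ⟨S, hS, h⟩
    obtain rfl := hocc hS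
    simp [init, ClosesLeft] at h
  · intro z hz
    rcases hcases z hz with h | h | h <;> simp [h]

theorem good_run (s : ℕ → Fin 3 → Bool) (m : ℕ) : (run s m).Good m := by
  induction m with
  | zero => exact good_init
  | succ m ih => exact ih.step (valid_run s m) (s m)

end Tangle

/-! ### Return to Catalan states -/

open Tangle

theorem BdryPt.isAbove_iff {m i : ℕ} {p : BdryPt m 3} :
    p.IsAbove i ↔ ∃ z : Pt, p.toEnd = .inl z ∧ z.InRows i := by
  cases p <;> simp [BdryPt.IsAbove, BdryPt.toEnd, Pt.InRows]

theorem horizontalCut_le_one {m : ℕ} {C : CatalanState m 3} {s : KauffmanState m 3}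
    (hC : Realizes s C) {q : Pt} {B : Set (Sym2 Pt)}
    (hrun : ∀ a b, s(a, b) ∈ B → (run s.extend m).Conn (.inl a) (.inl b)) (h : CutOnce m q B)
    {i : ℕ} (hi : i ≤ m) : C.horizontalCut i ≤ 1 := by
  -- Every point above the line other than `p₀` has its partner above the line too, so only the arc
  -- from `p₀` can cross it.
  obtain ⟨p₀, hp₀⟩ := h.2 i hi
  refine (Set.ncard_le_one_iff (Set.toFinite _)).2 ?_
  suffices ∀ p : BdryPt m 3, p.IsAbove i → ¬ (C.partner p).IsAbove i → p.toEnd = .inl p₀ by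
    intro p p' hp hp'
    exact BdryPt.toEnd_injective ((this p hp.1 hp.2).trans (this p' hp'.1 hp'.2).symm)
  intro p hp hp'
  obtain ⟨z, hz, hzi⟩ := BdryPt.isAbove_iff.1 hp
  by_contra hne
  obtain ⟨u, hui, hu⟩ := hp₀ z hzi fun hz₀ => hne (hz₀ ▸ hz)
  have hconn := hrun z u hu
  have hum : u.InRows m := ((valid_run _ m).arcsIn hconn).2.1
  obtain ⟨p', hp'u⟩ := BdryPt.exists_toEnd_eq (m := m) (a := .inl u) hum
  rw [← hz, ← hp'u, (components_of_smoothing s).2] at hconn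
  rw [(hC p p').2 hconn] at hp'
  exact hp' (BdryPt.isAbove_iff.2 ⟨u, hp'u, hui⟩)

theorem posMarkers_sub_negMarkers {m : ℕ} (s : KauffmanState m 3) :
    (posMarkers s : ℤ) - negMarkers s = ∑ i, markerSum (s i) := by
  simp only [posMarkers, negMarkers, Finset.card_filter, markerSum]
  push_cast
  rw [← Finset.sum_sub_distrib, Fintype.sum_prod_type]
  refine Finset.sum_congr rfl fun i _ => Finset.sum_congr rfl fun j _ => ?_
  cases s i j <;> simp

theorem CatalanState.coeff_eq_stateSum {m : ℕ} {C : CatalanState m 3} {s₀ : KauffmanState m 3}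
    (h₀ : Realizes s₀ C) :
    C.coeff = stateSum m fun S => ind (S = run s₀.extend m) := by
  rw [CatalanState.coeff, Finset.sum_filter, stateSum]
  refine Finset.sum_congr rfl fun s _ => ?_
  by_cases h : Realizes s C
  · rw [if_pos h, h₀.iff_run_eq.1 h, ind, if_pos rfl, mul_one, weight,
      (components_of_smoothing s).1, posMarkers_sub_negMarkers]
    rfl
  · rw [if_neg h, ind, if_neg fun hr => h (h₀.iff_run_eq.2 hr), mul_zero]

theorem CatalanState.hasForm_coeff {m : ℕ} {C : CatalanState m 3} (hC : C.Realizable) :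
    HasForm C.coeff (∀ i ≤ m, C.horizontalCut i ≤ 1) := by
  obtain ⟨s, hs⟩ := hC
  rw [CatalanState.coeff_eq_stateSum hs]
  have hgood := good_run s.extend m
  have hcut : ∀ q B, (∀ a b, s(a, b) ∈ B → (run s.extend m).Conn (.inl a) (.inl b)) →
      CutOnce m q B → ∀ i ≤ m, C.horizontalCut i ≤ 1 :=
    fun q B hB h i hi => horizontalCut_le_one hs hB h hi
  have hocc : Occurs m (run s.extend m) := ⟨_, rfl⟩
  generalize run s.extend m = S at *
  cases S with
  | three p q r B => exact IsAnalogueProduct.hasForm hgood.1 _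
  | capL q B =>
    obtain ⟨h1, h2⟩ := GoodClass.hasForm_capL hgood hocc
    exact ⟨h1, h2.imp_right (hcut q B fun a b h => h)⟩
  | capR q B =>
    obtain ⟨h1, h2⟩ := GoodClass.hasForm_capR hgood hocc
    exact ⟨h1, h2.imp_right (hcut q B fun a b h => h)⟩

theorem geomChi_mul (k : ℕ) :
    geomChi k * ((T 2 + T (-2)) ^ 2 - 1) = (T 2 + T (-2)) ^ (2 * k) - 1 := by
  rw [geomChi, ← chi, geom_sum_mul, ← pow_mul]

open LaurentPolynomial in
theorem corollary5 (m : ℕ) (C : CatalanState m 3) (hC : C.Realizable) :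
    -- `C(A)` is a power of `A` times a product of `[2]`, `[3]` at `A ^ 4` and a quotient
    (∃ (e : ℤ) (a b k : ℕ) (F : ℤ[T;T⁻¹]), 1 ≤ k ∧
      F * ((T 2 + T (-2)) ^ 2 - 1) = (T 2 + T (-2)) ^ (2 * k) - 1 ∧
      C.coeff = T e * qAnalogue (T 4) 2 ^ a * qAnalogue (T 4) 3 ^ b * F) ∧
    -- palindromic, extreme coefficients one, no gaps
    (∃ (d : ℤ) (N : ℕ) (c : ℕ → ℤ),
      C.coeff = ∑ i ∈ Finset.range (N + 1), LaurentPolynomial.C (c i) * T (d + 4 * (i : ℤ)) ∧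
      c 0 = 1 ∧ c N = 1 ∧
      (∀ i ≤ N, c i = c (N - i)) ∧
      (∀ i ≤ N, 0 < c i)) ∧
    -- a horizontal line cutting `C` in exactly three points
    ((∃ i ≤ m, C.horizontalCut i = 3) →
      ∃ (e : ℤ) (a b : ℕ),
        C.coeff = T e * qAnalogue (T 4) 2 ^ a * qAnalogue (T 4) 3 ^ b) := by
  obtain ⟨⟨M, k, hM, hk, hf⟩, h3⟩ := CatalanState.hasForm_coeff hC
  refine ⟨?_, ?_, ?_⟩
  · obtain ⟨e, a, b, rfl⟩ := hM
    exact ⟨e, a, b, k, geomChi k, hk, geomChi_mul k, hf⟩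
  · rw [hf]
    exact (hM.isPosPalindrome.mul (geomChi_isPosPalindrome hk)).exists_coeffs
  · rintro ⟨i, hi, hcut⟩
    rcases h3 with h3 | h3
    · exact h3
    -- Without a pure product the class is thin, so every cut is at most one, contradicting three.
    · have := h3 i hi
      omega
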